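/- Let $\mathcal X$ be a finite or countably infinite alphabet and let $\{X_n\}_{n\in\mathbb Z}$ be a stationary and ergodic $\mathcal X$-valued time series. Write $X_m^n=(X_m,\dots,X_n)$ (the empty string if $m>n$), and, for words $w\in\mathcal X^k$ ($k\ge 0$) and letters $y$, $p(w)=P(X_{-k+1}^0=w)$, $p(w,y)=P(X_{-k+1}^0=w,\,X_1=y)$ and $p(y|w)=P(X_1=y\mid X_{-k+1}^0=w)$ (when $p(w)>0$). The memory length $K(X_{-\infty}^0)$ is the smallest integer $0\le K<\infty$ such that for all $i\ge1$, $z\in\mathcal X^i$ and $y\in\mathcal X$ with $p(zX_{-K+1}^0,y)>0$ one has $p(y|X_{-K+1}^0)=p(y|zX_{-K+1}^0)$, and $K(X_{-\infty}^0)=\infty$ if there is no such $K$; here $zw$ denotes concatenation, $z$ preceding $w$ in time. Assume that $\{X_n\}$ is finitarily Markovian, i.e. $K(X_{-\infty}^0)<\infty$ almost surely. Fix arbitrary $0<\gamma<1$ and $0<\beta<\frac{1-\gamma}{2}$. From the data $X_{-n}^0$ define, for $w\in\mathcal X^k$ and $x\in\mathcal X$, $$\hat p_n(x|w)=\frac{\#\{-n+k-1\le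 t\le -1:\ X_{t-k+1}^{t+1}=(w,x)\}}{\#\{-n+k-1\le t\le -1:\ X_{t-k+1}^{t}=w\}},$$ let $\mathcal L_k^n$ be the set of words $v\in\mathcal X^{k+1}$ with $\#\{-n+k\le t\le 0:\ X_{t-k}^t=v\}>n^{1-\gamma}$, and put $$\hat\Delta_k^n(w)=\max_{1\le i\le n}\ \max_{(z,x)\in\mathcal X^i\times\mathcal X:\ (z,w,x)\in\mathcal L_{k+i}^n}\bigl|\hat p_n(x|w)-\hat p_n(x|zw)\bigr|,$$ where a maximum over an empty set is $0$. Say that $NTEST_n(w)=YES$ if $\hat\Delta_k^n(w)\le n^{-\beta}$, and $NO$ otherwise. Let $\chi_0=0$ and, for $n\ge1$, let $\chi_n$ be the smallest $0\le k<n$ with $NTEST_n(X_{-k+1}^0)=YES$ if there is such a $k$, and $\chi_n=n$ otherwise. Then, almost surely, $\chi_n=K(X_{-\infty}^0)$ for all sufficiently large $n$. -/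

import Mathlib

open MeasureTheory Filter

namespace FinitarilyMarkovian

noncomputable section

/-- The left shift on two-sided sequences. -/
def shift {α : Type*} (x : ℤ → α) : ℤ → α := fun i => x (i + 1)

/-- The word `x_{t-k+1}, …, x_t` of length `k` ending at time `t`, listed in increasing time;
it is the empty word for `k = 0`. -/
def seg {α : Type*} (x : ℤ → α) (t : ℤ) (k : ℕ) : List α :=
  (List.range k).map fun j : ℕ => x (t - k + 1 + j)

section Model

variable {Ω α : Type*} [MeasurableSpace Ω]

/-- The sample path of the process `X` at the outcome `ω`. -/
def path (X : ℤ → Ω → α) (ω : Ω) : ℤ → α := fun n => X n ω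

/-- `{X_n}` is a stationary and ergodic time series: the left shift preserves the law of the
process on `ℤ → α` and is ergodic for it. -/
def IsStationaryErgodic [MeasurableSpace α] (P : Measure Ω) (X : ℤ → Ω → α) : Prop :=
  (∀ n, Measurable (X n)) ∧ Ergodic (shift (α := α)) (P.map (path X))

/-- The event that the word `w` of length `k` equals `X_{-k+1}, …, X_0`. -/
def pastEvent (X : ℤ → Ω → α) (w : List α) : Set Ω :=
  {ω | seg (path X ω) 0 w.length = w}

/-- `p(w, y)`, the probability that `w` ends at time `0` and is followed by the letter `y`. -/
def jointProb (P : Measure Ω) (X : ℤ → Ω → α) (w : List α) (y : α) : ℝ :=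
  P.real (pastEvent X w ∩ {ω | X 1 ω = y})

/-- `p(y | w)`, the conditional probability that `X_1 = y` given that `w` ends at time `0`
(used only for words `w` of positive probability). -/
def condProb (P : Measure Ω) (X : ℤ → Ω → α) (y : α) (w : List α) : ℝ :=
  jointProb P X w y / P.real (pastEvent X w)

/-- Extending the word `w` into the past does not change the conditional distribution of the next
letter: `p(y | w) = p(y | z w)` for all non-empty words `z` and letters `y` with
`p(z, w, y) > 0`. -/
def PastIrrelevant (P : Measure Ω) (X : ℤ → Ω → α) (w : List α) : Prop :=
  ∀ (z : List α) (y : α), 1 ≤ z.length → 0 < jointProb P X (z ++ w) y →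
    condProb P X y w = condProb P X y (z ++ w)

/-- The memory length `K` of a sample path `x` of the process `X`: the smallest `k` for which
the word `x_{-k+1}, …, x_0` determines the conditional distribution of the next letter, and `∞`
if there is no such `k`. -/
def memoryLength (P : Measure Ω) (X : ℤ → Ω → α) (x : ℤ → α) : ℕ∞ :=
  ⨅ (k : ℕ) (_ : PastIrrelevant P X (seg x 0 k)), (k : ℕ∞)

/-- The process is finitarily Markovian: the memory length is almost surely finite. -/
def IsFinitarilyMarkovian (P : Measure Ω) (X : ℤ → Ω → α) : Prop :=
  ∀ᵐ ω ∂P, memoryLength P X (path X ω) < ⊤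

end Model

section Estimator

variable {α : Type*}

/-- The number of times `t` in `[a, b]` at which an occurrence of the word `w` in `x` ends. -/
def occ (x : ℤ → α) (w : List α) (a b : ℤ) : ℕ :=
  {t : ℤ | a ≤ t ∧ t ≤ b ∧ seg x t w.length = w}.ncard

/-- The empirical conditional probability of `y` given `w` of length `k`, from the data
`x_{-n}, …, x_0`: the number of `t` with `-n+k-1 ≤ t ≤ -1` and `x_{t-k+1}^{t+1} = (w, y)`,
divided by the number of `t` in the same range with `x_{t-k+1}^t = w`. -/
def empCond (n : ℕ) (x : ℤ → α) (y : α) (w : List α) : ℝ :=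
  ({t : ℤ | -(n : ℤ) + w.length - 1 ≤ t ∧ t ≤ -1 ∧
      seg x (t + 1) (w.length + 1) = w ++ [y]}.ncard : ℝ) /
    (occ x w (-(n : ℤ) + w.length - 1) (-1) : ℝ)

/-- The word `v` appears more than `n ^ (1 - γ)` times in `x_{-n}, …, x_0`. -/
def IsFrequent (γ : ℝ) (n : ℕ) (x : ℤ → α) (v : List α) : Prop :=
  (n : ℝ) ^ (1 - γ) < (occ x v (-(n : ℤ) + v.length - 1) 0 : ℝ)

/-- The values over which the empirical version of `Δ(w)` is maximized. -/
def empDeltaValues (γ : ℝ) (n : ℕ) (x : ℤ → α) (w : List α) : Set ℝ :=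
  {d | ∃ (z : List α) (y : α), 1 ≤ z.length ∧ z.length ≤ n ∧ IsFrequent γ n x (z ++ w ++ [y]) ∧
    d = |empCond n x y w - empCond n x y (z ++ w)|}

/-- The empirical version of `Δ(w)`: a maximum over a finite set of numbers in `[0, 1]`, which
is `0` if that set is empty (as is `sSup ∅` in `ℝ`). -/
def empDelta (γ : ℝ) (n : ℕ) (x : ℤ → α) (w : List α) : ℝ :=
  sSup (empDeltaValues γ n x w)

/-- The test whether `w` is a memory word, based on `x_{-n}, …, x_0`, answers "yes". -/
def NTest (γ β : ℝ) (n : ℕ) (x : ℤ → α) (w : List α) : Prop :=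
  empDelta γ n x w ≤ (n : ℝ) ^ (-β)

/-- The backward estimator: the smallest `k < n` such that the word `x_{-k+1}, …, x_0` passes the
test if there is such a `k`, and `n` otherwise (so it is `0` for `n = 0`). -/
def chi (γ β : ℝ) (n : ℕ) (x : ℤ → α) : ℕ :=
  sInf ({k : ℕ | k < n ∧ NTest γ β n x (seg x 0 k)} ∪ {n})

end Estimator

end

end FinitarilyMarkovian

/-! The test is eventually correct on every fixed word, almost surely. There are only countably many
words, so almost surely this holds for all of them at once. On a path with memory length K, only the
K + 1 suffixes of lengths 0, …, K matter, and once the test is right on these, `chi` equals K.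

Failure on non-memory words: some extension zw and letter y have p(zw, y) > 0 and p(y|w) ≠ p(y|zw).
By the ergodic theorem zwy occurs linearly often, hence more than n^(1-γ) times, and the empirical
probabilities converge to distinct limits, so their gap exceeds n^(-β) eventually
(`ae_eventually_not_nTest`).

Success on memory words: after any past ending in w, the next letter is y with a fixed probability Q
y (`PastIrrelevant.hasNextProb`). Occurrences of zw followed by y or not thus behave like
independent trials, and an exponential supermartingale gives a Chernoff bound of order exp(-c
n^(1-γ-2β)) up to polynomial factors. The alphabet may be infinite, so a plain union bound over z
and y is unavailable. Restricting to the event that zwy occurs in the window adds the factor Q y ·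
p(zw) to the bound, and these factors sum to at most 1 over all y and all z of a given length
(`measure_iUnion_deviation_le`). Borel–Cantelli concludes (`ae_eventually_nTest`). -/

namespace FinitarilyMarkovian

open scoped ENNReal Topology

noncomputable section

/-! ### Pointwise ergodic theorem for bounded functions. -/

section ErgodicTheorem

variable {S : Type*} {T : S → S} {g : S → ℝ}

/-- The maximum of `0` and the first `n` Birkhoff sums of `g`. -/
def maxBirkhoff (T : S → S) (g : S → ℝ) : ℕ → S → ℝ
  | 0, _ => 0
  | n + 1, x => max 0 (g x + maxBirkhoff T g n (T x))

lemma maxBirkhoff_nonneg (n : ℕ) (x : S) : 0 ≤ maxBirkhoff T g n x := by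
  cases n with
  | zero => exact le_rfl
  | succ n => exact le_max_left _ _

lemma maxBirkhoff_le_succ (n : ℕ) (x : S) : maxBirkhoff T g n x ≤ maxBirkhoff T g (n + 1) x := by
  induction n generalizing x with
  | zero => exact maxBirkhoff_nonneg _ _
  | succ n ih => exact max_le_max le_rfl (by linarith [ih (T x)])

lemma monotone_maxBirkhoff (x : S) : Monotone fun n => maxBirkhoff T g n x :=
  monotone_nat_of_le_succ fun n => maxBirkhoff_le_succ n x

lemma birkhoffSum_le_maxBirkhoff (n : ℕ) (x : S) :
    birkhoffSum T g n x ≤ maxBirkhoff T g n x := by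
  induction n generalizing x with
  | zero => simp [maxBirkhoff]
  | succ n ih =>
    rw [birkhoffSum_succ']
    exact le_trans (by linarith [ih (T x)]) (le_max_right _ _)

lemma maxBirkhoff_le_mul {C : ℝ} (hC : ∀ x, |g x| ≤ C) (n : ℕ) (x : S) :
    maxBirkhoff T g n x ≤ n * C := by
  induction n generalizing x with
  | zero => simp [maxBirkhoff]
  | succ n ih =>
    have h0 : 0 ≤ C := (abs_nonneg _).trans (hC x)
    refine max_le (by positivity) ?_
    have := ih (T x)
    have := (le_abs_self _).trans (hC x)
    push_cast
    linarith

/-- The recursion moves a bound between x and T x at the cost of g x. Hence the set where the maxima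
stay bounded is invariant, and ergodicity makes it null or conull. -/
lemma bddAbove_maxBirkhoff_comp_iff (x : S) :
    BddAbove (Set.range fun n => maxBirkhoff T g n (T x)) ↔
      BddAbove (Set.range fun n => maxBirkhoff T g n x) := by
  constructor
  · rintro ⟨c, hc⟩
    refine ⟨max 0 (g x + c), ?_⟩
    rintro _ ⟨n, rfl⟩
    have h := hc ⟨n, rfl⟩
    refine (maxBirkhoff_le_succ n x).trans (max_le_max le_rfl ?_)
    dsimp at h
    linarith
  · rintro ⟨c, hc⟩
    refine ⟨c - g x, ?_⟩
    rintro _ ⟨n, rfl⟩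
    have h := hc ⟨n + 1, rfl⟩
    have := (le_max_right 0 (g x + maxBirkhoff T g n (T x))).trans h
    dsimp
    linarith

variable [MeasurableSpace S]

lemma measurable_maxBirkhoff (hT : Measurable T) (hg : Measurable g) (n : ℕ) :
    Measurable (maxBirkhoff T g n) := by
  induction n with
  | zero => exact measurable_const
  | succ n ih => exact measurable_const.max (hg.add (ih.comp hT))

/-- If a bounded function has negative integral, its Birkhoff sums are almost surely bounded
above. -/
lemma ae_bddAbove_maxBirkhoff {μ : Measure S} [IsProbabilityMeasure μ] (hT : Ergodic T μ)
    (hg : Measurable g) {C : ℝ} (hC : ∀ x, |g x| ≤ C) (hneg : ∫ x, g x ∂μ < 0) :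
    ∀ᵐ x ∂μ, BddAbove (Set.range fun n => maxBirkhoff T g n x) := by
  have hTm := hT.measurable
  have hM := measurable_maxBirkhoff (T := T) (g := g) hTm hg
  set B : Set S := {x | BddAbove (Set.range fun n => maxBirkhoff T g n x)} with hB
  have hBm : MeasurableSet B := by
    have : B = ⋃ k : ℕ, ⋂ n : ℕ, {x | maxBirkhoff T g n x ≤ k} := by
      ext x
      simp only [hB, Set.mem_ofPred_eq, Set.mem_iUnion, Set.mem_iInter]
      constructor
      · rintro ⟨c, hc⟩
        obtain ⟨k, hk⟩ := exists_nat_ge c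
        exact ⟨k, fun n => (hc ⟨n, rfl⟩).trans hk⟩
      · rintro ⟨k, hk⟩
        exact ⟨k, by rintro _ ⟨n, rfl⟩; exact hk n⟩
    rw [this]
    exact .iUnion fun k => .iInter fun n => measurableSet_le (hM n) measurable_const
  have hinv : T ⁻¹' B = B := by
    ext x
    exact bddAbove_maxBirkhoff_comp_iff x
  rcases hT.toPreErgodic.ae_mem_or_ae_notMem hBm hinv with h | h
  · exact h
  exfalso
  have hint : ∀ n, Integrable (maxBirkhoff T g n) μ := fun n =>
    Integrable.of_bound (hM n).aestronglyMeasurable (n * C) <| ae_of_all _ fun x => by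
      rw [Real.norm_of_nonneg (maxBirkhoff_nonneg _ _)]
      exact maxBirkhoff_le_mul hC n x
  -- With M_n the maximal sums, the integrand is max(-M_n(T x), g x). It is bounded by C and equals
  -- g x as soon as M_n(T x) ≥ -g x, which happens eventually where the sums are unbounded.
  have hlim : Tendsto (fun n => ∫ x, (maxBirkhoff T g (n + 1) x - maxBirkhoff T g n (T x)) ∂μ)
      atTop (𝓝 (∫ x, g x ∂μ)) := by
    refine tendsto_integral_of_dominated_convergence (fun _ => C)
      (fun n => ((hM (n + 1)).sub ((hM n).comp hTm)).aestronglyMeasurable)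
      (integrable_const C) (fun n => ae_of_all _ fun x => ?_) ?_
    · have h1 := maxBirkhoff_nonneg (T := T) (g := g) n (T x)
      have h2 := abs_le.1 (hC x)
      rw [Real.norm_eq_abs, abs_le]
      simp only [maxBirkhoff]
      constructor
      · have := le_max_right 0 (g x + maxBirkhoff T g n (T x))
        linarith
      · rcases max_cases 0 (g x + maxBirkhoff T g n (T x)) with h | h <;> linarith
    · filter_upwards [h] with x hx
      have hx' : ¬ BddAbove (Set.range fun n => maxBirkhoff T g n (T x)) := fun h =>
        hx ((bddAbove_maxBirkhoff_comp_iff x).1 h)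
      have htop := tendsto_atTop_atTop_of_monotone' (monotone_maxBirkhoff (T x)) hx'
      refine tendsto_const_nhds.congr' ?_
      filter_upwards [htop.eventually_ge_atTop (-g x)] with n hn
      simp only [maxBirkhoff]
      rw [max_eq_right (by linarith)]
      ring
  -- By invariance each integral is ∫ (M_(n+1) - M_n), nonnegative by monotonicity; so ∫ g ≥ 0, a
  -- contradiction.
  refine absurd hneg (not_lt.2 (ge_of_tendsto' hlim fun n => ?_))
  have hcomp : ∫ x, maxBirkhoff T g n (T x) ∂μ = ∫ x, maxBirkhoff T g n x ∂μ := by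
    rw [← integral_map hTm.aemeasurable (by rw [hT.map_eq]; exact (hM n).aestronglyMeasurable),
      hT.map_eq]
  have hcompi : Integrable (fun x => maxBirkhoff T g n (T x)) μ :=
    (hT.toMeasurePreserving.integrable_comp (hM n).aestronglyMeasurable).2 (hint n)
  rw [integral_sub (hint _) hcompi, hcomp, sub_nonneg]
  exact integral_mono (hint _) (hint _) fun x => maxBirkhoff_le_succ n x

/-- Subtracting the mean plus ε/2 makes the integral negative, so the centred sums are bounded, and
the remaining n ε/2 outgrows the bound. -/
lemma ae_eventually_birkhoffSum_le {μ : Measure S} [IsProbabilityMeasure μ] (hT : Ergodic T μ)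
    {f : S → ℝ} (hf : Measurable f) {C : ℝ} (hC : ∀ x, |f x| ≤ C) {ε : ℝ} (hε : 0 < ε) :
    ∀ᵐ x ∂μ, ∀ᶠ n : ℕ in atTop, birkhoffSum T f n x ≤ n * (∫ x, f x ∂μ + ε) := by
  set c := ∫ x, f x ∂μ + ε / 2 with hc
  have hfi : Integrable f μ := Integrable.of_bound hf.aestronglyMeasurable C (ae_of_all _ hC)
  have h := ae_bddAbove_maxBirkhoff (g := fun x => f x - c) hT (hf.sub measurable_const)
    (C := C + |c|) (fun x => (abs_sub _ _).trans (by linarith [hC x])) (by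
      rw [integral_sub hfi (integrable_const c)]
      simp [hc, hε])
  filter_upwards [h] with x hx
  obtain ⟨K, hK⟩ := hx
  have htop : Tendsto (fun n : ℕ => (n : ℝ) * (ε / 2)) atTop atTop :=
    tendsto_natCast_atTop_atTop.atTop_mul_const (by linarith)
  filter_upwards [htop.eventually_ge_atTop K] with n hn
  have h1 := (birkhoffSum_le_maxBirkhoff (T := T) (g := fun x => f x - c) n x).trans (hK ⟨n, rfl⟩)
  simp only [birkhoffSum, Finset.sum_sub_distrib, Finset.sum_const, Finset.card_range,
    nsmul_eq_mul] at h1 ⊢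
  rw [hc] at h1
  linarith

/-- The pointwise ergodic theorem for bounded functions. -/
theorem ae_tendsto_birkhoffSum_div {μ : Measure S} [IsProbabilityMeasure μ] (hT : Ergodic T μ)
    {f : S → ℝ} (hf : Measurable f) {C : ℝ} (hC : ∀ x, |f x| ≤ C) :
    ∀ᵐ x ∂μ, Tendsto (fun n : ℕ => birkhoffSum T f n x / n) atTop (𝓝 (∫ x, f x ∂μ)) := by
  have h1 : ∀ᵐ x ∂μ, ∀ k : ℕ, ∀ᶠ n : ℕ in atTop,
      birkhoffSum T f n x ≤ n * (∫ x, f x ∂μ + 1 / ((k : ℝ) + 1)) :=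
    ae_all_iff.2 fun k => ae_eventually_birkhoffSum_le hT hf hC (by positivity)
  have h2 : ∀ᵐ x ∂μ, ∀ k : ℕ, ∀ᶠ n : ℕ in atTop,
      birkhoffSum T (-f) n x ≤ n * (∫ x, (-f) x ∂μ + 1 / ((k : ℝ) + 1)) :=
    ae_all_iff.2 fun k => ae_eventually_birkhoffSum_le hT hf.neg (C := C)
      (fun x => by simpa using hC x) (by positivity)
  filter_upwards [h1, h2] with x h1 h2
  rw [Metric.tendsto_nhds]
  intro ε hε
  obtain ⟨k, hk⟩ := exists_nat_one_div_lt hε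
  filter_upwards [h1 k, h2 k, eventually_gt_atTop 0] with n h1 h2 hn
  have hn' : (0 : ℝ) < n := by exact_mod_cast hn
  have e1 : birkhoffSum T (-f) n x = -birkhoffSum T f n x := by simp [birkhoffSum]
  have e2 : ∫ x, (-f) x ∂μ = -∫ x, f x ∂μ := by simp [integral_neg]
  rw [e1, e2] at h2
  have h3 : birkhoffSum T f n x / n ≤ ∫ x, f x ∂μ + 1 / ((k : ℝ) + 1) := by
    rw [div_le_iff₀ hn']; linarith
  have h4 : ∫ x, f x ∂μ - 1 / ((k : ℝ) + 1) ≤ birkhoffSum T f n x / n := by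
    rw [le_div_iff₀ hn']; linarith
  rw [Real.dist_eq, abs_lt]
  constructor <;> linarith

end ErgodicTheorem

/-! ### Words and cylinder sets. -/

section Words

variable {α : Type*}

@[simp] lemma length_seg (x : ℤ → α) (t : ℤ) (k : ℕ) : (seg x t k).length = k := by
  simp [seg]

lemma seg_add (x : ℤ → α) (t : ℤ) (i k : ℕ) : seg x t (i + k) = seg x (t - k) i ++ seg x t k := by
  simp only [seg, List.range_add, List.map_append, List.map_map]
  congr 1
  · refine List.map_congr_left fun j _ => ?_
    congr 1; push_cast; ring
  · refine List.map_congr_left fun j _ => ?_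
    simp only [Function.comp]
    congr 1; push_cast; ring

lemma seg_succ (x : ℤ → α) (t : ℤ) (k : ℕ) : seg x (t + 1) (k + 1) = seg x t k ++ [x (t + 1)] := by
  rw [seg_add]
  simp [seg]

lemma seg_shift (x : ℤ → α) (t : ℤ) (k : ℕ) : seg (shift x) t k = seg x (t + 1) k := by
  simp only [seg, shift]
  refine List.map_congr_left fun j _ => ?_
  congr 1; ring

lemma seg_congr {x x' : ℤ → α} {t : ℤ} {k : ℕ}
    (h : ∀ i, t - k < i → i ≤ t → x i = x' i) : seg x t k = seg x' t k := by
  refine List.map_congr_left fun j hj => h _ (by lia) ?_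
  have := List.mem_range.1 hj
  lia

lemma eq_of_seg_eq {x x' : ℤ → α} {t : ℤ} {k : ℕ} (h : seg x t k = seg x' t k) (i : ℤ)
    (h1 : t - k < i) (h2 : i ≤ t) : x i = x' i := by
  have h3 := List.map_inj_left.1 h (i - (t - k + 1)).toNat (List.mem_range.2 (by lia))
  rwa [show t - k + 1 + (((i - (t - k + 1)).toNat : ℕ) : ℤ) = i by lia] at h3

/-- The sequences in which an occurrence of the word `v` ends at time `t`. -/
def cyl (t : ℤ) (v : List α) : Set (ℤ → α) := {x | seg x t v.length = v}

lemma mem_cyl_append_iff {t : ℤ} {z w : List α} {x : ℤ → α} :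
    x ∈ cyl t (z ++ w) ↔ x ∈ cyl (t - w.length) z ∧ x ∈ cyl t w := by
  simp only [cyl, Set.mem_ofPred_eq, List.length_append, seg_add]
  constructor
  · intro h
    exact List.append_inj h (by simp)
  · rintro ⟨h1, h2⟩
    rw [h1, h2]

lemma mem_cyl_concat_iff {t : ℤ} {v : List α} {y : α} {x : ℤ → α} :
    x ∈ cyl (t + 1) (v ++ [y]) ↔ x ∈ cyl t v ∧ x (t + 1) = y := by
  rw [mem_cyl_append_iff]
  simp [cyl, seg]

lemma preimage_shift_cyl (t : ℤ) (v : List α) : shift ⁻¹' cyl t v = cyl (t + 1) v := by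
  ext x
  simp [cyl, seg_shift]

variable [MeasurableSpace α]

lemma measurable_shift : Measurable (shift (α := α)) :=
  measurable_pi_lambda _ fun i => measurable_pi_apply (i + 1)

variable [MeasurableSingletonClass α]

lemma measurableSet_seg_eq (t : ℤ) (k : ℕ) (u : List α) :
    MeasurableSet {x : ℤ → α | seg x t k = u} := by
  induction k generalizing t u with
  | zero => simp [seg]
  | succ k ih =>
    have h1 : ∀ x : ℤ → α, seg x t (k + 1) = seg x (t - 1) k ++ [x t] := fun x => by
      simpa using seg_succ x (t - 1) k
    rcases u.eq_nil_or_concat with rfl | ⟨v, y, rfl⟩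
    · simp [h1]
    · have h : {x : ℤ → α | seg x t (k + 1) = v ++ [y]} =
          {x | seg x (t - 1) k = v} ∩ (fun x => x t) ⁻¹' {y} := by
        ext x
        simp only [h1, Set.mem_ofPred_eq, Set.mem_inter_iff, Set.mem_preimage,
          Set.mem_singleton_iff]
        constructor
        · intro h
          simpa using List.append_inj' h rfl
        · rintro ⟨h, rfl⟩
          rw [h]
      rw [List.concat_eq_append, h]
      exact (ih _ _).inter (measurable_pi_apply t (measurableSet_singleton y))

lemma measurableSet_cyl (t : ℤ) (v : List α) : MeasurableSet (cyl t v) :=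
  measurableSet_seg_eq t _ v

/-- All cylinders over a word have the same probability under a stationary law. -/
lemma measure_cyl_eq {μ : Measure (ℤ → α)} (hμ : MeasurePreserving shift μ μ) (t : ℤ)
    (v : List α) : μ (cyl t v) = μ (cyl 0 v) := by
  have h : ∀ s : ℤ, μ (cyl (s + 1) v) = μ (cyl s v) := fun s => by
    rw [← preimage_shift_cyl]
    exact hμ.measure_preimage (measurableSet_cyl s v).nullMeasurableSet
  induction t using Int.induction_on with
  | zero => rfl
  | succ i ih => rw [h, ih]
  | pred i ih => rw [← ih, ← h, sub_add_cancel]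

end Words

/-! ### Exponential supermartingale along the occurrences of a word. -/

section Concentration

variable {α : Type*} [MeasurableSpace α] {μ : Measure (ℤ → α)} {v : List α} {y : α} {q : ℝ≥0∞}

/-- A function of a two-sided sequence that depends only on finitely many coordinates up to
time `t`. -/
def DependsOnPast {α β : Type*} (t : ℤ) (G : (ℤ → α) → β) : Prop :=
  ∃ M : ℕ, ∀ x x' : ℤ → α, (∀ i, t - M < i → i ≤ t → x i = x' i) → G x = G x'

variable (μ v y q) in
/-- Given any past that ends with the word `v`, the next letter is `y` with probability `q`. -/
def HasNextProb : Prop :=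
  ∀ u : List α, μ (cyl 0 (u ++ v ++ [y])) = q * μ (cyl 0 (u ++ v))

lemma HasNextProb.append {w : List α} (h : HasNextProb μ w y q) (z : List α) :
    HasNextProb μ (z ++ w) y q := fun u => by
  simpa only [List.append_assoc] using h (u ++ z)

variable [MeasurableSingletonClass α]

open scoped Classical in
/-- The factor `A` if `v` ends at time `t` and is followed by `y`, `B` if it ends at time `t` and
is followed by another letter, and `1` otherwise. -/
def stepFactor {α : Type*} (v : List α) (y : α) (A B : ℝ≥0∞) (t : ℤ) (x : ℤ → α) : ℝ≥0∞ :=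
  if x ∈ cyl (t + 1) (v ++ [y]) then A else if x ∈ cyl t v then B else 1

lemma measurable_stepFactor (A B : ℝ≥0∞) (t : ℤ) : Measurable (stepFactor v y A B t) :=
  Measurable.ite (measurableSet_cyl _ _) measurable_const
    (Measurable.ite (measurableSet_cyl _ _) measurable_const measurable_const)

/-- The product of the first `m` factors from time `b` on. -/
def weight {α : Type*} (v : List α) (y : α) (A B : ℝ≥0∞) (b : ℤ) (m : ℕ) (x : ℤ → α) : ℝ≥0∞ :=
  ∏ j ∈ Finset.range m, stepFactor v y A B (b + j) x

lemma measurable_weight (A B : ℝ≥0∞) (b : ℤ) (m : ℕ) : Measurable (weight v y A B b m) :=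
  Finset.measurable_fun_prod _ fun _ _ => measurable_stepFactor _ _ _

/-- One of the first `m` positions from time `b` on is the end of an occurrence of `v`. -/
def occursFrom {α : Type*} (v : List α) (b : ℤ) (m : ℕ) : Set (ℤ → α) :=
  {x | ∃ j < m, x ∈ cyl (b + (j : ℕ)) v}

lemma measurableSet_occursFrom (b : ℤ) (m : ℕ) : MeasurableSet (occursFrom v b m) := by
  have : occursFrom v b m = ⋃ j : ℕ, ⋃ _ : j < m, cyl (b + j) v := by
    ext x
    simp [occursFrom]
  rw [this]
  exact .iUnion fun _ => .iUnion fun _ => measurableSet_cyl _ _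

variable [Countable α]

/-- G is a function of a finite word ending at time t. Words form a countable set, so it suffices to
compare two measures on single words: those ending in v are covered by `HasNextProb`, the others
carry no mass. -/
lemma DependsOnPast.setLIntegral_next [IsProbabilityMeasure μ] (hμ : MeasurePreserving shift μ μ)
    (h : HasNextProb μ v y q) {t : ℤ} {G : (ℤ → α) → ℝ≥0∞}
    (hG : DependsOnPast t G) :
    ∫⁻ x in cyl (t + 1) (v ++ [y]), G x ∂μ = q * ∫⁻ x in cyl t v, G x ∂μ ∧
      ∫⁻ x in cyl t v \ cyl (t + 1) (v ++ [y]), G x ∂μ = (1 - q) * ∫⁻ x in cyl t v, G x ∂μ := by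
  obtain ⟨M, hM⟩ := hG
  let _ : MeasurableSpace (List α) := ⊤
  set φ : (ℤ → α) → List α := fun x => seg x t (M + v.length) with hφ
  have hφm : Measurable φ := measurable_to_countable' fun u => measurableSet_seg_eq _ _ u
  obtain ⟨G', rfl⟩ : ∃ G' : List α → ℝ≥0∞, G' ∘ φ = G := by
    refine ⟨_, Function.FactorsThrough.extend_comp (g := G) (e' := fun _ => 0) ?_⟩
    intro x x' hx
    exact hM x x' fun i h1 h2 => eq_of_seg_eq hx i (by push_cast; lia) h2
  have hG' : Measurable G' := fun _ _ => trivial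
  have hsub : cyl (t + 1) (v ++ [y]) ⊆ cyl t v := fun x hx => (mem_cyl_concat_iff.1 hx).1
  have key : ∀ D : Set (ℤ → α), MeasurableSet D → D ⊆ cyl t v → ∀ r : ℝ≥0∞,
      (∀ u : List α, μ (cyl t (u ++ v) ∩ D) = r * μ (cyl t (u ++ v))) →
      ∫⁻ x in D, (G' ∘ φ) x ∂μ = r * ∫⁻ x in cyl t v, (G' ∘ φ) x ∂μ := by
    intro D hD hDv r hr
    have hmap : (μ.restrict D).map φ = r • (μ.restrict (cyl t v)).map φ := by
      refine Measure.ext_of_singleton fun u => ?_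
      have hu : MeasurableSet (φ ⁻¹' {u}) := hφm trivial
      rw [Measure.smul_apply, Measure.map_apply hφm trivial, Measure.map_apply hφm trivial,
        Measure.restrict_apply hu, Measure.restrict_apply hu, smul_eq_mul]
      by_cases hne : (φ ⁻¹' {u} ∩ cyl t v).Nonempty
      · obtain ⟨x, hx1, hx2⟩ := hne
        have hux : u = seg x (t - v.length) M ++ v := by
          rw [← show φ x = u from hx1, hφ]
          dsimp only
          rw [seg_add, show seg x t v.length = v from hx2]
        have hpre : φ ⁻¹' {u} = cyl t (seg x (t - v.length) M ++ v) := by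
          ext x'
          simp [hφ, cyl, hux]
        have hsubv : cyl t (seg x (t - v.length) M ++ v) ⊆ cyl t v := fun x' hx' =>
          (mem_cyl_append_iff.1 hx').2
        rw [hpre, hr, Set.inter_eq_left.2 hsubv]
      · rw [Set.not_nonempty_iff_eq_empty] at hne
        have hD0 : φ ⁻¹' {u} ∩ D = ∅ :=
          Set.subset_empty_iff.1 (hne ▸ Set.inter_subset_inter_right _ hDv)
        rw [hne, hD0]
        simp
    calc ∫⁻ x in D, (G' ∘ φ) x ∂μ = ∫⁻ u, G' u ∂((μ.restrict D).map φ) :=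
          (lintegral_map hG' hφm).symm
      _ = r * ∫⁻ u, G' u ∂((μ.restrict (cyl t v)).map φ) := by
          rw [hmap, lintegral_smul_measure, smul_eq_mul]
      _ = _ := by rw [lintegral_map hG' hφm]; rfl
  have hnext : ∀ u : List α, cyl t (u ++ v) ∩ cyl (t + 1) (v ++ [y]) =
      cyl (t + 1) (u ++ v ++ [y]) := fun u => by
    ext x
    rw [Set.mem_inter_iff, mem_cyl_concat_iff, mem_cyl_concat_iff, mem_cyl_append_iff]
    tauto
  have hprob : ∀ u : List α, μ (cyl t (u ++ v) ∩ cyl (t + 1) (v ++ [y])) =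
      q * μ (cyl t (u ++ v)) := fun u => by
    rw [hnext, measure_cyl_eq hμ, h u, measure_cyl_eq hμ t]
  refine ⟨key _ (measurableSet_cyl _ _) hsub _ hprob,
    key _ ((measurableSet_cyl _ _).diff (measurableSet_cyl _ _)) Set.sdiff_subset _ fun u => ?_⟩
  have hd : cyl t (u ++ v) ∩ (cyl t v \ cyl (t + 1) (v ++ [y])) =
      cyl t (u ++ v) \ (cyl t (u ++ v) ∩ cyl (t + 1) (v ++ [y])) := by
    ext x
    simp only [Set.mem_inter_iff, Set.mem_sdiff, mem_cyl_append_iff]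
    tauto
  rw [hd, measure_sdiff Set.inter_subset_left
    ((measurableSet_cyl _ _).inter (measurableSet_cyl _ _)).nullMeasurableSet
    (measure_ne_top _ _), hprob, ENNReal.sub_mul (fun _ _ => measure_ne_top _ _), one_mul]

/-- The supermartingale step: on an occurrence of v the factor averages to q A + (1 - q) B ≤ 1 given
the past, and elsewhere it is 1. -/
lemma lintegral_mul_stepFactor_le [IsProbabilityMeasure μ] (hμ : MeasurePreserving shift μ μ)
    (h : HasNextProb μ v y q) {A B : ℝ≥0∞} (hAB : q * A + (1 - q) * B ≤ 1) {t : ℤ}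
    {G : (ℤ → α) → ℝ≥0∞} (hG : DependsOnPast t G) (hGm : Measurable G) :
    ∫⁻ x, G x * stepFactor v y A B t x ∂μ ≤ ∫⁻ x, G x ∂μ := by
  have hv := measurableSet_cyl t v
  have hy := measurableSet_cyl (t + 1) (v ++ [y])
  have hsub : cyl (t + 1) (v ++ [y]) ⊆ cyl t v := fun x hx => (mem_cyl_concat_iff.1 hx).1
  obtain ⟨e1, e2⟩ := hG.setLIntegral_next hμ h
  rw [← lintegral_add_compl _ hv, ← lintegral_add_compl (fun x => G x) hv]
  refine add_le_add ?_ (le_of_eq ?_)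
  · rw [← lintegral_inter_add_sdiff _ (cyl t v) hy, Set.inter_eq_right.2 hsub]
    have f1 : ∫⁻ x in cyl (t + 1) (v ++ [y]), G x * stepFactor v y A B t x ∂μ =
        (q * ∫⁻ x in cyl t v, G x ∂μ) * A := by
      rw [← e1, ← lintegral_mul_const _ hGm]
      exact setLIntegral_congr_fun hy fun x hx => by simp [stepFactor, hx]
    have f2 : ∫⁻ x in cyl t v \ cyl (t + 1) (v ++ [y]), G x * stepFactor v y A B t x ∂μ =
        ((1 - q) * ∫⁻ x in cyl t v, G x ∂μ) * B := by
      rw [← e2, ← lintegral_mul_const _ hGm]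
      exact setLIntegral_congr_fun (hv.diff hy) fun x hx => by simp [stepFactor, hx.1, hx.2]
    rw [f1, f2]
    calc _ = (q * A + (1 - q) * B) * ∫⁻ x in cyl t v, G x ∂μ := by ring
      _ ≤ 1 * ∫⁻ x in cyl t v, G x ∂μ := by gcongr
      _ = _ := one_mul _
  · refine setLIntegral_congr_fun hv.compl fun x hx => ?_
    have hx' : x ∉ cyl (t + 1) (v ++ [y]) := fun h => hx (hsub h)
    have hx : x ∉ cyl t v := hx
    simp [stepFactor, hx, hx']

lemma mem_cyl_congr {α : Type*} {v : List α} {t : ℤ} {x x' : ℤ → α}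
    (h : ∀ i, t - v.length < i → i ≤ t → x i = x' i) : x ∈ cyl t v ↔ x' ∈ cyl t v := by
  simp only [cyl, Set.mem_ofPred_eq, seg_congr h]

lemma weight_congr {α : Type*} {v : List α} {y : α} {A B : ℝ≥0∞} {b : ℤ} {m : ℕ} {x x' : ℤ → α}
    (h : ∀ i, b - v.length < i → i ≤ b + m → x i = x' i) :
    weight v y A B b m x = weight v y A B b m x' := by
  refine Finset.prod_congr rfl fun j hj => ?_
  have hj := Finset.mem_range.1 hj
  have h1 : x ∈ cyl (b + j) v ↔ x' ∈ cyl (b + j) v :=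
    mem_cyl_congr fun i h1 h2 => h i (by lia) (by lia)
  have h2 : x ∈ cyl (b + j + 1) (v ++ [y]) ↔ x' ∈ cyl (b + j + 1) (v ++ [y]) :=
    mem_cyl_congr fun i h1 h2 => h i (by simp at h1; lia) (by lia)
  unfold stepFactor
  split_ifs <;> tauto

lemma dependsOnPast_indicator_weight {α : Type*} {v : List α} {y : α} {A B : ℝ≥0∞} {b : ℤ}
    {m : ℕ} {E : Set (ℤ → α)}
    (hE : ∀ x x' : ℤ → α, (∀ i, b - v.length < i → i ≤ b + m → x i = x' i) →
      (x ∈ E ↔ x' ∈ E)) :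
    DependsOnPast (b + m) (E.indicator (weight v y A B b m)) := by
  classical
  refine ⟨m + v.length, fun x x' hx => ?_⟩
  have hx' : ∀ i, b - v.length < i → i ≤ b + m → x i = x' i := fun i h1 h2 =>
    hx i (by push_cast; lia) h2
  simp only [Set.indicator, hE x x' hx', weight_congr hx']

/-- The window may reach time b + m, one position beyond the last factor of the weight, because that
factor already looks one letter ahead. -/
lemma dependsOnPast_occursFrom_succ {α : Type*} {v : List α} {y : α} {A B : ℝ≥0∞} {b : ℤ}
    {m : ℕ} :
    DependsOnPast (b + m) ((occursFrom v b (m + 1)).indicator (weight v y A B b m)) := by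
  refine dependsOnPast_indicator_weight fun x x' h => ?_
  refine exists_congr fun j => and_congr_right fun hj => mem_cyl_congr fun i h1 h2 => ?_
  exact h i (by lia) (by lia)

lemma dependsOnPast_occursFrom_concat {α : Type*} {v : List α} {y : α} {A B : ℝ≥0∞} {b : ℤ}
    {m : ℕ} :
    DependsOnPast (b + m)
      ((occursFrom (v ++ [y]) (b + 1) m).indicator (weight v y A B b m)) := by
  refine dependsOnPast_indicator_weight fun x x' h => ?_
  refine exists_congr fun j => and_congr_right fun hj => mem_cyl_congr fun i h1 h2 => ?_
  simp at h1
  exact h i (by lia) (by lia)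

/-- Before v first occurs the weight is 1, so a first occurrence at a given time contributes at most
μ(v); afterwards the supermartingale step applies. The indicator is what yields the factor μ(v)
instead of the bound 1. -/
lemma lintegral_occursFrom_weight_le [IsProbabilityMeasure μ] (hμ : MeasurePreserving shift μ μ)
    (h : HasNextProb μ v y q) {A B : ℝ≥0∞} (hAB : q * A + (1 - q) * B ≤ 1) (b : ℤ)
    (m : ℕ) :
    ∫⁻ x, (occursFrom v b (m + 1)).indicator (weight v y A B b m) x ∂μ ≤
      (m + 1) * μ (cyl 0 v) := by
  induction m with
  | zero =>
    have : ∀ x, (occursFrom v b 1).indicator (weight v y A B b 0) x =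
        (cyl b v).indicator 1 x := fun x => by
      have : occursFrom v b 1 = cyl b v := by ext x; simp [occursFrom]
      rw [this]
      simp [weight, Set.indicator]
    simp only [zero_add, this]
    rw [lintegral_indicator_one (measurableSet_cyl _ _), measure_cyl_eq hμ]
    simp
  | succ m ih =>
    have hle : ∀ x, (occursFrom v b (m + 1 + 1)).indicator (weight v y A B b (m + 1)) x ≤
        (occursFrom v b (m + 1)).indicator (weight v y A B b m) x *
          stepFactor v y A B (b + m) x + (cyl (b + (m + 1 : ℕ)) v).indicator 1 x := by
      intro x
      by_cases hx : x ∈ occursFrom v b (m + 1)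
      · have hx2 : x ∈ occursFrom v b (m + 1 + 1) := by
          obtain ⟨j, hj, hx⟩ := hx
          exact ⟨j, by lia, hx⟩
        rw [Set.indicator_of_mem hx, Set.indicator_of_mem hx2, weight, Finset.prod_range_succ]
        exact le_self_add
      · by_cases hx2 : x ∈ occursFrom v b (m + 1 + 1)
        · have hx3 : x ∈ cyl (b + (m + 1 : ℕ)) v := by
            obtain ⟨j, hj, hxj⟩ := hx2
            rcases Nat.lt_succ_iff_lt_or_eq.1 hj with hj' | rfl
            · exact absurd ⟨j, hj', hxj⟩ hx
            · exact hxj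
          have hw : weight v y A B b (m + 1) x = 1 := by
            refine Finset.prod_eq_one fun j hj => ?_
            have hj' : x ∉ cyl (b + j) v := fun hxj => hx ⟨j, Finset.mem_range.1 hj, hxj⟩
            simp [stepFactor, mem_cyl_concat_iff, hj']
          rw [Set.indicator_of_mem hx2, Set.indicator_of_mem hx3, hw]
          exact le_add_self
        · rw [Set.indicator_of_notMem hx2]
          exact zero_le
    have hm : Measurable ((occursFrom v b (m + 1)).indicator (weight v y A B b m)) :=
      (measurable_weight _ _ _ _).indicator (measurableSet_occursFrom _ _)
    refine (lintegral_mono hle).trans ?_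
    rw [lintegral_add_left (by exact hm.mul (measurable_stepFactor _ _ _)),
      lintegral_indicator_one (measurableSet_cyl _ _), measure_cyl_eq hμ]
    have := (lintegral_mul_stepFactor_le hμ h hAB dependsOnPast_occursFrom_succ hm).trans ih
    calc _ ≤ (m + 1) * μ (cyl 0 v) + μ (cyl 0 v) := by gcongr
      _ = _ := by push_cast; ring

/-- A first occurrence of vy forces v one step earlier, and reading y then costs A q. By the
preceding bound the new contribution at step m is at most A q (m + 1) μ(v), and these add up to at
most the square. -/
lemma lintegral_occursFrom_concat_weight_le [IsProbabilityMeasure μ]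
    (hμ : MeasurePreserving shift μ μ) (h : HasNextProb μ v y q) {A B : ℝ≥0∞}
    (hAB : q * A + (1 - q) * B ≤ 1) (b : ℤ) (m : ℕ) :
    ∫⁻ x, (occursFrom (v ++ [y]) (b + 1) m).indicator (weight v y A B b m) x ∂μ ≤
      A * q * μ (cyl 0 v) * m ^ 2 := by
  induction m with
  | zero => simp [occursFrom]
  | succ m ih =>
    set G := (occursFrom v b (m + 1)).indicator (weight v y A B b m) with hG
    have hle : ∀ x, (occursFrom (v ++ [y]) (b + 1) (m + 1)).indicator
          (weight v y A B b (m + 1)) x ≤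
        (occursFrom (v ++ [y]) (b + 1) m).indicator (weight v y A B b m) x *
          stepFactor v y A B (b + m) x +
        (cyl (b + m + 1) (v ++ [y])).indicator (fun x => G x * A) x := by
      intro x
      have hw : weight v y A B b (m + 1) x =
          weight v y A B b m x * stepFactor v y A B (b + m) x := Finset.prod_range_succ _ _
      by_cases hx : x ∈ occursFrom (v ++ [y]) (b + 1) m
      · have hx2 : x ∈ occursFrom (v ++ [y]) (b + 1) (m + 1) := by
          obtain ⟨j, hj, hx⟩ := hx
          exact ⟨j, by lia, hx⟩
        rw [Set.indicator_of_mem hx, Set.indicator_of_mem hx2, hw]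
        exact le_self_add
      · by_cases hx2 : x ∈ occursFrom (v ++ [y]) (b + 1) (m + 1)
        · have hx3 : x ∈ cyl (b + m + 1) (v ++ [y]) := by
            obtain ⟨j, hj, hxj⟩ := hx2
            rcases Nat.lt_succ_iff_lt_or_eq.1 hj with hj' | rfl
            · exact absurd ⟨j, hj', hxj⟩ hx
            · rwa [add_right_comm] at hxj
          have hx4 : x ∈ occursFrom v b (m + 1) := ⟨m, by lia, (mem_cyl_concat_iff.1 hx3).1⟩
          rw [Set.indicator_of_mem hx2, Set.indicator_of_mem hx3, hw, hG,
            Set.indicator_of_mem hx4]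
          simp [stepFactor, hx3]
        · rw [Set.indicator_of_notMem hx2]
          exact zero_le
    have hm : Measurable ((occursFrom (v ++ [y]) (b + 1) m).indicator (weight v y A B b m)) :=
      (measurable_weight _ _ _ _).indicator (measurableSet_occursFrom _ _)
    have hGm : Measurable G :=
      (measurable_weight _ _ _ _).indicator (measurableSet_occursFrom _ _)
    have h2 : ∫⁻ x in cyl (b + m + 1) (v ++ [y]), G x * A ∂μ ≤
        A * q * μ (cyl 0 v) * (m + 1) := by
      rw [lintegral_mul_const _ hGm, (DependsOnPast.setLIntegral_next hμ h
        (t := b + m) dependsOnPast_occursFrom_succ).1]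
      calc q * (∫⁻ x in cyl (b + m) v, G x ∂μ) * A
          ≤ q * ((m + 1) * μ (cyl 0 v)) * A := by
            gcongr
            exact (setLIntegral_le_lintegral _ _).trans
              (lintegral_occursFrom_weight_le hμ h hAB b m)
        _ = _ := by ring
    refine (lintegral_mono hle).trans ?_
    rw [lintegral_add_left (by exact hm.mul (measurable_stepFactor _ _ _)),
      lintegral_indicator (measurableSet_cyl _ _)]
    have h1 := (lintegral_mul_stepFactor_le hμ h hAB dependsOnPast_occursFrom_concat hm).trans ih
    calc _ ≤ A * q * μ (cyl 0 v) * m ^ 2 + A * q * μ (cyl 0 v) * (m + 1) := by gcongr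
      _ = A * q * μ (cyl 0 v) * (m ^ 2 + (m + 1)) := by ring
      _ ≤ A * q * μ (cyl 0 v) * ((m + 1 : ℕ) : ℝ≥0∞) ^ 2 := by
        gcongr
        have : m ^ 2 + (m + 1) ≤ (m + 1) ^ 2 := by nlinarith
        exact_mod_cast this

end Concentration

/-! ### Chernoff bounds, uniform over extensions and letters. -/

section Deviation

/-- The number of occurrences of `v` in `x` that end at one of the times `b, …, b + m - 1`. -/
def count {α : Type*} (v : List α) (b : ℤ) (m : ℕ) (x : ℤ → α) : ℝ :=
  ∑ j ∈ Finset.range m, (cyl (b + (j : ℕ)) v).indicator 1 x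

/-- Use e^s ≤ 1 + s + s² for |s| ≤ 1: the linear terms cancel, and the quadratic ones are at most
l², absorbed by e^(l²). -/
lemma exp_mul_bernoulli_le {p l : ℝ} (hp0 : 0 ≤ p) (hp1 : p ≤ 1) (hl : |l| ≤ 1) :
    p * Real.exp (l * (1 - p) - l ^ 2) + (1 - p) * Real.exp (-l * p - l ^ 2) ≤ 1 := by
  have hexp : ∀ s : ℝ, |s| ≤ 1 → Real.exp s ≤ 1 + s + s ^ 2 := fun s hs => by
    have := (abs_le.1 (Real.abs_exp_sub_one_sub_id_le hs)).2
    linarith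
  have h1 : Real.exp (l * (1 - p)) ≤ 1 + l * (1 - p) + (l * (1 - p)) ^ 2 := hexp _ <| by
    rw [abs_mul, abs_of_nonneg (sub_nonneg.2 hp1)]
    exact mul_le_one₀ hl (by linarith) (by linarith)
  have h2 : Real.exp (-l * p) ≤ 1 + -l * p + (-l * p) ^ 2 := hexp _ <| by
    rw [abs_mul, abs_neg, abs_of_nonneg hp0]
    exact mul_le_one₀ hl hp0 hp1
  have h3 : p * Real.exp (l * (1 - p)) + (1 - p) * Real.exp (-l * p) ≤ 1 + l ^ 2 := by
    have h4 := mul_le_mul_of_nonneg_left h1 hp0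
    have h5 := mul_le_mul_of_nonneg_left h2 (sub_nonneg.2 hp1)
    have h6 : p * (1 - p) ≤ 1 := by nlinarith
    nlinarith [mul_le_mul_of_nonneg_left h6 (sq_nonneg l)]
  have h7 : 1 + l ^ 2 ≤ Real.exp (l ^ 2) := by linarith [Real.add_one_le_exp (l ^ 2)]
  rw [Real.exp_sub, Real.exp_sub, mul_div_assoc', mul_div_assoc', ← add_div,
    div_le_one (Real.exp_pos _)]
  exact h3.trans h7

lemma weight_eq_exp {α : Type*} (v : List α) (y : α) (p l : ℝ) (b : ℤ) (m : ℕ) (x : ℤ → α) :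
    weight v y (ENNReal.ofReal (Real.exp (l * (1 - p) - l ^ 2)))
        (ENNReal.ofReal (Real.exp (-l * p - l ^ 2))) b m x =
      ENNReal.ofReal (Real.exp (l * (count (v ++ [y]) (b + 1) m x - p * count v b m x) -
        l ^ 2 * count v b m x)) := by
  have e : l * (count (v ++ [y]) (b + 1) m x - p * count v b m x) - l ^ 2 * count v b m x =
      ∑ j ∈ Finset.range m, (l * ((cyl (b + 1 + (j : ℕ)) (v ++ [y])).indicator 1 x -
        p * (cyl (b + (j : ℕ)) v).indicator 1 x) -
          l ^ 2 * (cyl (b + (j : ℕ)) v).indicator 1 x) := by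
    simp only [count, Finset.mul_sum, Finset.sum_sub_distrib, mul_sub]
  rw [e, Real.exp_sum, ENNReal.ofReal_prod_of_nonneg fun _ _ => (Real.exp_pos _).le, weight]
  refine Finset.prod_congr rfl fun j _ => ?_
  rw [add_right_comm, stepFactor]
  by_cases h1 : x ∈ cyl (b + j + 1) (v ++ [y])
  · have h2 := (mem_cyl_concat_iff.1 h1).1
    simp [h1, h2]
  · by_cases h2 : x ∈ cyl (b + j) v
    · simp [h1, h2]
    · simp [h1, h2]

variable {α : Type*} [MeasurableSpace α] {μ : Measure (ℤ → α)} {v : List α} {y : α} {q : ℝ≥0∞}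
variable [MeasurableSingletonClass α] [Countable α] [IsProbabilityMeasure μ]

/-- Markov's inequality for the weight: on this event its exponent is at least 2 l² N - l² N = l² N
≥ l² r, where N counts the occurrences of v. -/
lemma measure_oneSided_deviation_le (hμ : MeasurePreserving shift μ μ)
    (h : HasNextProb μ v y q) (hq : q ≤ 1) {l : ℝ} (hl : |l| ≤ 1) (r : ℝ) (b : ℤ) (m : ℕ) :
    μ {x | x ∈ occursFrom (v ++ [y]) (b + 1) m ∧ r ≤ count v b m x ∧
        2 * l ^ 2 * count v b m x ≤
          l * (count (v ++ [y]) (b + 1) m x - q.toReal * count v b m x)} ≤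
      ENNReal.ofReal (Real.exp (1 - l ^ 2 * r)) * (q * μ (cyl 0 v)) * m ^ 2 := by
  set p := q.toReal with hp
  have hq' : q = ENNReal.ofReal p := (ENNReal.ofReal_toReal (hq.trans_lt ENNReal.one_lt_top).ne).symm
  have hp0 : 0 ≤ p := ENNReal.toReal_nonneg
  have hp1 : p ≤ 1 := ENNReal.toReal_le_of_le_ofReal zero_le_one (by simpa using hq)
  set A := ENNReal.ofReal (Real.exp (l * (1 - p) - l ^ 2)) with hA
  set B := ENNReal.ofReal (Real.exp (-l * p - l ^ 2)) with hB
  have hAB : q * A + (1 - q) * B ≤ 1 := by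
    rw [hq', hA, hB, ← ENNReal.ofReal_one, ← ENNReal.ofReal_sub _ hp0, ← ENNReal.ofReal_mul hp0,
      ← ENNReal.ofReal_mul (sub_nonneg.2 hp1), ← ENNReal.ofReal_add (by positivity)
        (mul_nonneg (sub_nonneg.2 hp1) (Real.exp_pos _).le)]
    exact ENNReal.ofReal_le_ofReal (exp_mul_bernoulli_le hp0 hp1 hl)
  have hA1 : A ≤ ENNReal.ofReal (Real.exp 1) := by
    refine ENNReal.ofReal_le_ofReal (Real.exp_le_exp.2 ?_)
    have := abs_le.1 hl
    nlinarith [sq_nonneg l]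
  set L := ENNReal.ofReal (Real.exp (l ^ 2 * r)) with hL
  have hL0 : L ≠ 0 := by simp [hL, Real.exp_pos]
  have hsub : {x | x ∈ occursFrom (v ++ [y]) (b + 1) m ∧ r ≤ count v b m x ∧
      2 * l ^ 2 * count v b m x ≤ l * (count (v ++ [y]) (b + 1) m x - p * count v b m x)} ⊆
      {x | L ≤ (occursFrom (v ++ [y]) (b + 1) m).indicator (weight v y A B b m) x} := by
    rintro x ⟨h1, h2, h3⟩
    rw [Set.mem_ofPred_eq, Set.indicator_of_mem h1, hA, hB, weight_eq_exp]
    refine ENNReal.ofReal_le_ofReal (Real.exp_le_exp.2 ?_)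
    nlinarith [mul_le_mul_of_nonneg_left h2 (sq_nonneg l)]
  have hm : Measurable ((occursFrom (v ++ [y]) (b + 1) m).indicator (weight v y A B b m)) :=
    (measurable_weight _ _ _ _).indicator (measurableSet_occursFrom _ _)
  calc _ ≤ (∫⁻ x, (occursFrom (v ++ [y]) (b + 1) m).indicator (weight v y A B b m) x ∂μ) / L :=
        (measure_mono hsub).trans (meas_ge_le_lintegral_div hm.aemeasurable hL0 (by simp [hL]))
    _ ≤ (ENNReal.ofReal (Real.exp 1) * q * μ (cyl 0 v) * m ^ 2) / L := by
        gcongr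
        refine (lintegral_occursFrom_concat_weight_le hμ h hAB b m).trans ?_
        gcongr
    _ = _ := by
        rw [Real.exp_sub, ENNReal.ofReal_div_of_pos (Real.exp_pos _), ← hL]
        simp only [div_eq_mul_inv]
        ring

lemma measure_deviation_le (hμ : MeasurePreserving shift μ μ)
    (h : HasNextProb μ v y q) (hq : q ≤ 1) {ε : ℝ} (hε0 : 0 ≤ ε) (hε : ε ≤ 1) (r : ℝ) (b : ℤ)
    (m : ℕ) :
    μ {x | x ∈ occursFrom (v ++ [y]) (b + 1) m ∧ r ≤ count v b m x ∧
        ε * count v b m x ≤ |count (v ++ [y]) (b + 1) m x - q.toReal * count v b m x|} ≤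
      q * μ (cyl 0 v) * (2 * ENNReal.ofReal (Real.exp (1 - ε ^ 2 / 4 * r)) * m ^ 2) := by
  -- For l = ±ε/2 one has 2 l² = |l| ε, so the one-sided events cover both signs of a deviation ε N.
  have h1 := measure_oneSided_deviation_le hμ h hq (l := ε / 2)
    (by rw [abs_of_nonneg (by linarith)]; linarith) r b m
  have h2 := measure_oneSided_deviation_le hμ h hq (l := -(ε / 2))
    (by rw [abs_neg, abs_of_nonneg (by linarith)]; linarith) r b m
  rw [show (ε / 2) ^ 2 = ε ^ 2 / 4 by ring] at h1
  rw [show (-(ε / 2)) ^ 2 = ε ^ 2 / 4 by ring] at h2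
  refine (measure_mono ?_).trans ((measure_union_le _ _).trans ((add_le_add h1 h2).trans_eq ?_))
  · rintro x ⟨h3, h4, h5⟩
    rcases le_abs.1 h5 with h6 | h6
    · exact Or.inl ⟨h3, h4, by nlinarith⟩
    · exact Or.inr ⟨h3, h4, by nlinarith⟩
  · ring

/-- Words `z` of a fixed length and letters `y` are treated simultaneously. -/
lemma measure_iUnion_deviation_le (hμ : MeasurePreserving shift μ μ) {w : List α}
    {Q : α → ℝ≥0∞} (h : ∀ y, HasNextProb μ w y (Q y)) (hQ : ∑' y, Q y ≤ 1) {ε : ℝ}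
    (hε0 : 0 ≤ ε) (hε : ε ≤ 1) (r : ℝ) (b : ℤ) (m i : ℕ) :
    μ {x | ∃ (z : List α) (y : α), z.length = i ∧ x ∈ occursFrom (z ++ w ++ [y]) (b + 1) m ∧
        r ≤ count (z ++ w) b m x ∧ ε * count (z ++ w) b m x ≤
          |count (z ++ w ++ [y]) (b + 1) m x - (Q y).toReal * count (z ++ w) b m x|} ≤
      2 * ENNReal.ofReal (Real.exp (1 - ε ^ 2 / 4 * r)) * m ^ 2 := by
  set K := 2 * ENNReal.ofReal (Real.exp (1 - ε ^ 2 / 4 * r)) * (m : ℝ≥0∞) ^ 2 with hK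
  have hQ1 : ∀ y, Q y ≤ 1 := fun y => (ENNReal.le_tsum y).trans hQ
  let D : {z : List α // z.length = i} → α → Set (ℤ → α) := fun z y =>
    {x | x ∈ occursFrom (z.1 ++ w ++ [y]) (b + 1) m ∧ r ≤ count (z.1 ++ w) b m x ∧
      ε * count (z.1 ++ w) b m x ≤
        |count (z.1 ++ w ++ [y]) (b + 1) m x - (Q y).toReal * count (z.1 ++ w) b m x|}
  have hsub : {x | ∃ (z : List α) (y : α), z.length = i ∧
      x ∈ occursFrom (z ++ w ++ [y]) (b + 1) m ∧
        r ≤ count (z ++ w) b m x ∧ ε * count (z ++ w) b m x ≤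
          |count (z ++ w ++ [y]) (b + 1) m x - (Q y).toReal * count (z ++ w) b m x|} ⊆
      ⋃ z, ⋃ y, D z y := by
    rintro x ⟨z, y, hz, hx⟩
    exact Set.mem_iUnion.2 ⟨⟨z, hz⟩, Set.mem_iUnion.2 ⟨y, hx⟩⟩
  have hD : ∀ z y, μ (D z y) ≤ Q y * μ (cyl 0 (z.1 ++ w)) * K := fun z y =>
    measure_deviation_le hμ ((h y).append z.1) (hQ1 y) hε0 hε r b m
  -- Words of one length index disjoint cylinders, so their probabilities sum to at most 1, however
  -- large the alphabet.
  have hdisj : ∑' z : {z : List α // z.length = i}, μ (cyl 0 (z.1 ++ w)) ≤ 1 := by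
    refine (tsum_meas_le_meas_iUnion_of_disjoint μ (fun z => measurableSet_cyl _ _) ?_).trans
      prob_le_one
    intro z z' hzz
    refine Set.disjoint_left.2 fun x hx hx' => hzz (Subtype.ext ?_)
    have h1 : seg x (0 - w.length) z.1.length = z.1 := (mem_cyl_append_iff.1 hx).1
    have h2 : seg x (0 - w.length) z'.1.length = z'.1 := (mem_cyl_append_iff.1 hx').1
    rw [← h1, ← h2, z.2, z'.2]
  calc _ ≤ ∑' z, ∑' y, μ (D z y) := (measure_mono hsub).trans <|
        (measure_iUnion_le _).trans (ENNReal.tsum_le_tsum fun z => measure_iUnion_le _)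
    _ ≤ ∑' z : {z : List α // z.length = i}, ∑' y, Q y * μ (cyl 0 (z.1 ++ w)) * K :=
        ENNReal.tsum_le_tsum fun z => ENNReal.tsum_le_tsum fun y => hD z y
    _ = (∑' y, Q y) * (∑' z : {z : List α // z.length = i}, μ (cyl 0 (z.1 ++ w))) * K := by
        simp only [ENNReal.tsum_mul_right, ENNReal.tsum_mul_left]
    _ ≤ 1 * 1 * K := by gcongr
    _ = K := by ring

end Deviation

/-! ### Empirical quantities as window counts. -/

section Counting

variable {α : Type*}

lemma count_nonneg (v : List α) (b : ℤ) (m : ℕ) (x : ℤ → α) : 0 ≤ count v b m x :=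
  Finset.sum_nonneg fun _ _ => Set.indicator_nonneg (fun _ _ => zero_le_one) _

lemma count_concat_le (v : List α) (y : α) (b : ℤ) (m : ℕ) (x : ℤ → α) :
    count (v ++ [y]) (b + 1) m x ≤ count v b m x := by
  refine Finset.sum_le_sum fun j _ => ?_
  refine Set.indicator_le_indicator_of_subset (fun x hx => ?_) (fun _ => zero_le_one) x
  rw [add_right_comm] at hx
  exact (mem_cyl_concat_iff.1 hx).1

lemma mem_occursFrom_of_count_pos {v : List α} {b : ℤ} {m : ℕ} {x : ℤ → α}
    (h : 0 < count v b m x) : x ∈ occursFrom v b m := by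
  by_contra hx
  refine h.ne' (Finset.sum_eq_zero fun j hj => ?_)
  exact Set.indicator_of_notMem (fun h' => hx ⟨j, Finset.mem_range.1 hj, h'⟩) _

lemma ncard_setOf_mem_cyl (x : ℤ → α) (v : List α) (a c d : ℤ) :
    ({t : ℤ | a ≤ t ∧ t ≤ c ∧ x ∈ cyl (t + d) v}.ncard : ℝ) =
      count v (a + d) (c + 1 - a).toNat x := by
  classical
  set m := (c + 1 - a).toNat with hm
  have h : {t : ℤ | a ≤ t ∧ t ≤ c ∧ x ∈ cyl (t + d) v} = (fun j : ℕ => a + (j : ℤ)) ''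
      ((Finset.range m).filter fun j : ℕ => x ∈ cyl (a + d + j) v : Finset ℕ) := by
    ext t
    simp only [Set.mem_ofPred_eq, Set.mem_image, Finset.coe_filter, Finset.mem_range]
    constructor
    · rintro ⟨h1, h2, h3⟩
      refine ⟨(t - a).toNat, ⟨by lia, ?_⟩, by lia⟩
      rwa [show a + d + ((t - a).toNat : ℤ) = t + d by lia]
    · rintro ⟨j, ⟨h1, h2⟩, rfl⟩
      refine ⟨by lia, by lia, ?_⟩
      rwa [add_right_comm]
  rw [h, Set.ncard_image_of_injective _ (fun i j hij => by simpa using hij), Set.ncard_coe_finset,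
    Finset.natCast_card_filter, count]
  exact Finset.sum_congr rfl fun j _ => by simp [Set.indicator]

lemma occ_eq_count (x : ℤ → α) (v : List α) (a c : ℤ) :
    (occ x v a c : ℝ) = count v a (c + 1 - a).toNat x := by
  simpa [occ, cyl] using ncard_setOf_mem_cyl x v a c 0

/-- The numerator is indexed by the time of y, hence its shift by one; both windows then have the
same length and can be compared term by term. -/
lemma empCond_eq (n : ℕ) (x : ℤ → α) (y : α) (v : List α) :
    empCond n x y v =
      count (v ++ [y]) (-(n : ℤ) + v.length - 1 + 1) (n + 1 - v.length) x /
        count v (-(n : ℤ) + v.length - 1) (n + 1 - v.length) x := by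
  have h1 := ncard_setOf_mem_cyl x (v ++ [y]) (-(n : ℤ) + v.length - 1) (-1) 1
  have h2 : (-1 + 1 - (-(n : ℤ) + v.length - 1)).toNat = n + 1 - v.length := by lia
  simp only [cyl, List.length_append, List.length_singleton, Set.mem_ofPred_eq] at h1
  rw [empCond, occ_eq_count, h1, h2]

lemma isFrequent_concat_iff {γ : ℝ} {n : ℕ} {x : ℤ → α} {v : List α} {y : α} :
    IsFrequent γ n x (v ++ [y]) ↔ (n : ℝ) ^ (1 - γ) <
      count (v ++ [y]) (-(n : ℤ) + v.length - 1 + 1) (n + 1 - v.length) x := by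
  have h1 : -(n : ℤ) + (v ++ [y]).length - 1 = -(n : ℤ) + v.length - 1 + 1 := by simp; ring
  have h2 : (0 + 1 - (-(n : ℤ) + v.length - 1 + 1)).toNat = n + 1 - v.length := by lia
  rw [IsFrequent, occ_eq_count, h1, h2]

lemma IsFrequent.of_append {γ : ℝ} {n : ℕ} {x : ℤ → α} {z v : List α}
    (h : IsFrequent γ n x (z ++ v)) : IsFrequent γ n x v := by
  refine lt_of_lt_of_le h (Nat.cast_le.2 (Set.ncard_le_ncard ?_ ?_))
  · rintro t ⟨h1, h2, h3⟩
    refine ⟨by simp at h1; lia, h2, (mem_cyl_append_iff.1 h3).2⟩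
  · exact (Set.finite_Icc (-(n : ℤ) + v.length - 1) 0).subset fun t ht => ⟨ht.1, ht.2.1⟩

lemma empCond_mem_Icc (n : ℕ) (x : ℤ → α) (y : α) (v : List α) :
    empCond n x y v ∈ Set.Icc (0 : ℝ) 1 := by
  rw [empCond_eq]
  exact ⟨div_nonneg (count_nonneg _ _ _ _) (count_nonneg _ _ _ _),
    div_le_one_of_le₀ (count_concat_le _ _ _ _ _) (count_nonneg _ _ _ _)⟩

lemma bddAbove_empDeltaValues (γ : ℝ) (n : ℕ) (x : ℤ → α) (w : List α) :
    BddAbove (empDeltaValues γ n x w) := by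
  refine ⟨1, ?_⟩
  rintro _ ⟨z, y, -, -, -, rfl⟩
  have h1 := empCond_mem_Icc n x y w
  have h2 := empCond_mem_Icc n x y (z ++ w)
  exact abs_sub_le_iff.2 ⟨by linarith [h1.2, h2.1], by linarith [h1.1, h2.2]⟩

end Counting

/-! ### Memory words eventually pass the test. -/

section MemoryWords

lemma summable_cube_mul_exp_neg_rpow {δ : ℝ} (hδ : 0 < δ) :
    Summable fun n : ℕ => 2 * ((n : ℝ) + 1) ^ 3 * Real.exp (1 - (n : ℝ) ^ δ / 16) := by
  -- The power 5/δ turns n^δ into n^5: three powers absorb the cubic factor and two remain for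
  -- summability.
  have h1 : Tendsto (fun n : ℕ => ((n : ℝ) ^ δ) ^ (5 / δ) * Real.exp (-(1 / 16) * (n : ℝ) ^ δ))
      atTop (𝓝 0) :=
    (tendsto_rpow_mul_exp_neg_mul_atTop_nhds_zero (5 / δ) (1 / 16) (by norm_num)).comp
      ((tendsto_rpow_atTop hδ).comp tendsto_natCast_atTop_atTop)
  refine Summable.of_norm_bounded_eventually_nat
    (g := fun n : ℕ => 16 * Real.exp 1 * (1 / (n : ℝ) ^ 2))
    ((Real.summable_one_div_nat_pow.2 (by norm_num)).mul_left _) ?_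
  filter_upwards [h1.eventually_le_const zero_lt_one, eventually_ge_atTop 1] with n hn hn1
  have hn0 : (1 : ℝ) ≤ n := by exact_mod_cast hn1
  have e1 : ((n : ℝ) ^ δ) ^ (5 / δ) = (n : ℝ) ^ 5 := by
    rw [← Real.rpow_mul (by positivity), mul_div_cancel₀ _ hδ.ne']
    exact_mod_cast Real.rpow_natCast (n : ℝ) 5
  rw [e1] at hn
  have e2 : Real.exp (1 - (n : ℝ) ^ δ / 16) =
      Real.exp 1 * Real.exp (-(1 / 16) * (n : ℝ) ^ δ) := by
    rw [← Real.exp_add]; congr 1; ring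
  rw [Real.norm_of_nonneg (by positivity), e2]
  have h2 : ((n : ℝ) + 1) ^ 3 ≤ 8 * (n : ℝ) ^ 3 := by
    calc ((n : ℝ) + 1) ^ 3 ≤ (2 * (n : ℝ)) ^ 3 := by gcongr; linarith
      _ = _ := by ring
  have h3 : (n : ℝ) ^ 3 * Real.exp (-(1 / 16) * (n : ℝ) ^ δ) ≤ 1 / (n : ℝ) ^ 2 := by
    rw [le_div_iff₀ (by positivity)]
    calc _ = (n : ℝ) ^ 5 * Real.exp (-(1 / 16) * (n : ℝ) ^ δ) := by ring
      _ ≤ 1 := hn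
  calc _ ≤ 2 * (8 * (n : ℝ) ^ 3) * (Real.exp 1 * Real.exp (-(1 / 16) * (n : ℝ) ^ δ)) := by gcongr
    _ = 16 * Real.exp 1 * ((n : ℝ) ^ 3 * Real.exp (-(1 / 16) * (n : ℝ) ^ δ)) := by ring
    _ ≤ _ := by gcongr

variable {α : Type*}

/-- The sequences for which some extension of `w` by at most `n` letters, followed by a letter
`y`, is frequent while its empirical probability is not close to `Q y`. -/
def deviationEvent (γ β : ℝ) (Q : α → ℝ≥0∞) (w : List α) (n : ℕ) : Set (ℤ → α) :=
  {x | ∃ (z : List α) (y : α), z.length ≤ n ∧ IsFrequent γ n x (z ++ w ++ [y]) ∧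
    (n : ℝ) ^ (-β) / 2 < |empCond n x y (z ++ w) - (Q y).toReal|}

/-- Triangle inequality through Q y: both w and zw have empirical probability within half the
threshold. Frequency of zwy passes to wy, so w itself is covered as the extension by the empty word.
-/
lemma nTest_of_notMem_deviationEvent {γ β : ℝ} {Q : α → ℝ≥0∞} {w : List α} {n : ℕ} {x : ℤ → α}
    (h : x ∉ deviationEvent γ β Q w n) : NTest γ β n x w := by
  refine Real.sSup_le ?_ (by positivity)
  rintro _ ⟨z, y, -, hz, hf, rfl⟩
  have hclose : ∀ z' : List α, z'.length ≤ n → IsFrequent γ n x (z' ++ w ++ [y]) →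
      |empCond n x y (z' ++ w) - (Q y).toReal| ≤ (n : ℝ) ^ (-β) / 2 := fun z' h1 h2 =>
    not_lt.1 fun h3 => h ⟨z', y, h1, h2, h3⟩
  have h1 := hclose z hz hf
  have h2 := hclose [] (by simp) (by
    rw [List.append_assoc] at hf
    exact hf.of_append)
  rw [List.nil_append] at h2
  rw [abs_le] at *
  constructor <;> linarith

variable [MeasurableSpace α] [MeasurableSingletonClass α] [Countable α] {μ : Measure (ℤ → α)}
  [IsProbabilityMeasure μ]

/-- The fixed-length bound with ε = n^(-β)/2 and r = n^(1-γ), for which ε² r / 4 = n^(1-γ-2β)/16, is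
summed over the n + 1 possible lengths of z. -/
lemma measure_deviationEvent_le (hμ : MeasurePreserving shift μ μ) {w : List α}
    {Q : α → ℝ≥0∞} (h : ∀ y, HasNextProb μ w y (Q y)) (hQ : ∑' y, Q y ≤ 1) {γ β : ℝ}
    (hβ0 : 0 < β) (hβ1 : β < (1 - γ) / 2) (n : ℕ) :
    μ (deviationEvent γ β Q w n) ≤ ENNReal.ofReal
      (2 * ((n : ℝ) + 1) ^ 3 * Real.exp (1 - (n : ℝ) ^ (1 - γ - 2 * β) / 16)) := by
  have hn0 : (0 : ℝ) ≤ n := n.cast_nonneg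
  set ε := (n : ℝ) ^ (-β) / 2 with hε
  set r := (n : ℝ) ^ (1 - γ) with hr
  have hε0 : 0 ≤ ε := by positivity
  have hε1 : ε ≤ 1 := by
    rcases Nat.eq_zero_or_pos n with rfl | hn
    · simp [hε, Real.zero_rpow (neg_ne_zero.2 hβ0.ne')]
    · have := Real.rpow_le_one_of_one_le_of_nonpos (x := (n : ℝ)) (z := -β)
        (by exact_mod_cast hn) (by linarith)
      linarith
  have hexp : (n : ℝ) ^ (1 - γ - 2 * β) / 16 = ε ^ 2 / 4 * r := by
    rcases Nat.eq_zero_or_pos n with rfl | hn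
    · have h1 : 1 - γ - 2 * β ≠ 0 := by linarith
      simp [hε, Real.zero_rpow (neg_ne_zero.2 hβ0.ne'), Real.zero_rpow h1]
    · have hn' : (0 : ℝ) < n := by exact_mod_cast hn
      rw [show 1 - γ - 2 * β = -β + -β + (1 - γ) by ring, Real.rpow_add hn', Real.rpow_add hn']
      ring
  let b : ℕ → ℤ := fun i => -(n : ℤ) + (i + w.length : ℕ) - 1
  let m : ℕ → ℕ := fun i => n + 1 - (i + w.length)
  let E : ℕ → Set (ℤ → α) := fun i =>
    {x | ∃ (z : List α) (y : α), z.length = i ∧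
      x ∈ occursFrom (z ++ w ++ [y]) (b i + 1) (m i) ∧ r ≤ count (z ++ w) (b i) (m i) x ∧
        ε * count (z ++ w) (b i) (m i) x ≤ |count (z ++ w ++ [y]) (b i + 1) (m i) x -
          (Q y).toReal * count (z ++ w) (b i) (m i) x|}
  have hsub : deviationEvent γ β Q w n ⊆ ⋃ i ∈ Finset.range (n + 1), E i := by
    rintro x ⟨z, y, hz, hf, hd⟩
    refine Set.mem_biUnion (x := z.length) (Finset.mem_coe.2 (Finset.mem_range.2 (by lia))) ?_
    rw [isFrequent_concat_iff, List.length_append] at hf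
    rw [empCond_eq, List.length_append] at hd
    have hle := count_concat_le (z ++ w) y (b z.length) (m z.length) x
    have hpos : 0 < count (z ++ w ++ [y]) (b z.length + 1) (m z.length) x :=
      lt_of_le_of_lt (by positivity) hf
    refine ⟨z, y, rfl, mem_occursFrom_of_count_pos hpos, hf.le.trans hle, ?_⟩
    have hN := hpos.trans_le hle
    calc ε * count (z ++ w) (b z.length) (m z.length) x
        ≤ |count (z ++ w ++ [y]) (b z.length + 1) (m z.length) x /
            count (z ++ w) (b z.length) (m z.length) x - (Q y).toReal| *
            count (z ++ w) (b z.length) (m z.length) x :=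
          mul_le_mul_of_nonneg_right hd.le hN.le
      _ = _ := by
          rw [← abs_of_pos hN, ← abs_mul, abs_of_pos hN, sub_mul, div_mul_cancel₀ _ hN.ne']
  have hE : ∀ i ∈ Finset.range (n + 1), μ (E i) ≤
      2 * ENNReal.ofReal (Real.exp (1 - ε ^ 2 / 4 * r)) * ((n : ℝ≥0∞) + 1) ^ 2 := fun i _ => by
    refine (measure_iUnion_deviation_le hμ h hQ hε0 hε1 r (b i) (m i) i).trans ?_
    gcongr
    exact_mod_cast (show m i ≤ n + 1 from Nat.sub_le _ _)
  calc μ (deviationEvent γ β Q w n) ≤ ∑ i ∈ Finset.range (n + 1), μ (E i) :=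
        (measure_mono hsub).trans (measure_biUnion_finset_le _ _)
    _ ≤ ∑ i ∈ Finset.range (n + 1),
          2 * ENNReal.ofReal (Real.exp (1 - ε ^ 2 / 4 * r)) * ((n : ℝ≥0∞) + 1) ^ 2 :=
        Finset.sum_le_sum hE
    _ = ENNReal.ofReal (2 * ((n : ℝ) + 1) ^ 3 * Real.exp (1 - ε ^ 2 / 4 * r)) := by
        rw [ENNReal.ofReal_mul (by positivity), ENNReal.ofReal_mul (by positivity),
          ENNReal.ofReal_pow (by positivity), ENNReal.ofReal_add hn0 zero_le_one]
        simp only [Finset.sum_const, Finset.card_range, nsmul_eq_mul, ENNReal.ofReal_natCast,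
          ENNReal.ofReal_one, ENNReal.ofReal_ofNat]
        push_cast
        ring
    _ = _ := by rw [hexp]

/-- A memory word eventually passes the test. -/
lemma ae_eventually_nTest (hμ : MeasurePreserving shift μ μ) {w : List α}
    {Q : α → ℝ≥0∞} (h : ∀ y, HasNextProb μ w y (Q y)) (hQ : ∑' y, Q y ≤ 1) {γ β : ℝ}
    (hβ0 : 0 < β) (hβ1 : β < (1 - γ) / 2) :
    ∀ᵐ x ∂μ, ∀ᶠ n : ℕ in atTop, NTest γ β n x w := by
  have hs := summable_cube_mul_exp_neg_rpow (δ := 1 - γ - 2 * β) (by linarith)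
  -- Borel–Cantelli; the exponent 1 - γ - 2β is positive exactly because β < (1 - γ)/2.
  have h1 := ae_eventually_notMem (μ := μ) (s := deviationEvent γ β Q w) <|
    ne_top_of_le_ne_top hs.tsum_ofReal_ne_top <|
      ENNReal.tsum_le_tsum (measure_deviationEvent_le hμ h hQ hβ0 hβ1)
  filter_upwards [h1] with x hx
  filter_upwards [hx] with n hn
  exact nTest_of_notMem_deviationEvent hn

end MemoryWords

/-! ### Law of large numbers; non-memory words eventually fail the test. -/

section LawOfLargeNumbers

variable {α : Type*} [MeasurableSpace α]

variable (α) in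
/-- The left shift as a measurable equivalence. -/
def shiftEquiv : (ℤ → α) ≃ᵐ (ℤ → α) where
  toFun := shift
  invFun x i := x (i - 1)
  left_inv x := by ext i; simp [shift]
  right_inv x := by ext i; simp [shift]
  measurable_toFun := measurable_shift
  measurable_invFun := measurable_pi_lambda _ fun i => measurable_pi_apply (i - 1)

lemma iterate_shiftEquiv_symm_mem_cyl_iff (j : ℕ) (t : ℤ) (v : List α) (x : ℤ → α) :
    (shiftEquiv α).symm^[j] x ∈ cyl t v ↔ x ∈ cyl (t - j) v := by
  induction j generalizing x with
  | zero => simp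
  | succ j ih =>
    rw [Function.iterate_succ_apply, ih, show t - (j : ℕ) = t - (j + 1 : ℕ) + 1 by push_cast; ring,
      ← preimage_shift_cyl, Set.mem_preimage]
    exact iff_of_eq (congrArg (· ∈ cyl _ v) ((shiftEquiv α).apply_symm_apply x))

/-- The window ends at the fixed time c - 1 and grows into the past, so the relevant dynamics is the
inverse shift. -/
lemma count_eq_birkhoffSum (v : List α) (c : ℤ) (m : ℕ) (x : ℤ → α) :
    count v (c - m) m x =
      birkhoffSum (shiftEquiv α).symm ((cyl (c - 1) v).indicator (1 : (ℤ → α) → ℝ)) m x := by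
  classical
  rw [count, birkhoffSum, ← Finset.sum_range_reflect]
  refine Finset.sum_congr rfl fun j hj => ?_
  have hj := Finset.mem_range.1 hj
  simp only [Set.indicator, iterate_shiftEquiv_symm_mem_cyl_iff]
  rw [show c - (m : ℤ) + ((m - 1 - j : ℕ) : ℤ) = c - 1 - j by lia]
  rfl

variable [MeasurableSingletonClass α] {μ : Measure (ℤ → α)} [IsProbabilityMeasure μ]

lemma ae_tendsto_count_div (hμ : Ergodic shift μ) (v : List α) (c : ℤ) :
    ∀ᵐ x ∂μ, Tendsto (fun m : ℕ => count v (c - m) m x / m) atTop (𝓝 (μ.real (cyl 0 v))) := by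
  have he : Ergodic (shiftEquiv α).symm μ := Ergodic.symm (e := shiftEquiv α) hμ
  have hm := measurableSet_cyl (c - 1) v
  have h := ae_tendsto_birkhoffSum_div he
    (f := (cyl (c - 1) v).indicator (1 : (ℤ → α) → ℝ)) (measurable_one.indicator hm) (C := 1)
    fun x => by by_cases hx : x ∈ cyl (c - 1) v <;> simp [hx]
  rw [integral_indicator_one hm, measureReal_def,
    measure_cyl_eq hμ.toMeasurePreserving, ← measureReal_def] at h
  filter_upwards [h] with x hx
  simpa only [count_eq_birkhoffSum] using hx

lemma tendsto_window (k : ℕ) : Tendsto (fun n : ℕ => n + 1 - k) atTop atTop :=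
  tendsto_atTop_mono (fun n => by lia) (tendsto_sub_atTop_nat k)

lemma start_eq {n k : ℕ} (h : k ≤ n + 1) : -(n : ℤ) + k - 1 = 0 - ((n + 1 - k : ℕ) : ℤ) := by
  lia

lemma ae_tendsto_empCond (hμ : Ergodic shift μ) (v : List α) (y : α) (hv : μ.real (cyl 0 v) ≠ 0) :
    ∀ᵐ x ∂μ, Tendsto (fun n : ℕ => empCond n x y v) atTop
      (𝓝 (μ.real (cyl 0 (v ++ [y])) / μ.real (cyl 0 v))) := by
  -- The numerator's window ends at time 0, the denominator's at time -1, hence c = 1 and c = 0.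
  filter_upwards [ae_tendsto_count_div hμ (v ++ [y]) 1, ae_tendsto_count_div hμ v 0] with x h1 h2
  refine ((h1.div h2 hv).comp (tendsto_window v.length)).congr' ?_
  filter_upwards [eventually_ge_atTop v.length] with n hn
  have hm : ((n + 1 - v.length : ℕ) : ℝ) ≠ 0 := by
    have : n + 1 - v.length ≠ 0 := by lia
    exact_mod_cast this
  rw [empCond_eq, start_eq (by lia), show ∀ a : ℤ, 0 - a + 1 = 1 - a by intro a; ring]
  exact div_div_div_cancel_right₀ hm _ _

lemma ae_eventually_isFrequent (hμ : Ergodic shift μ) {γ : ℝ} (hγ : 0 < γ) (v : List α) (y : α)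
    (hv : 0 < μ.real (cyl 0 (v ++ [y]))) :
    ∀ᵐ x ∂μ, ∀ᶠ n : ℕ in atTop, IsFrequent γ n x (v ++ [y]) := by
  set p := μ.real (cyl 0 (v ++ [y])) with hp
  filter_upwards [ae_tendsto_count_div hμ (v ++ [y]) 1] with x h1
  have h2 : Tendsto (fun n : ℕ => (n : ℝ) ^ (-γ)) atTop (𝓝 0) :=
    (tendsto_rpow_neg_atTop hγ).comp tendsto_natCast_atTop_atTop
  -- For large n the count exceeds p/2 times the window length, which is at least n/2; this gives p
  -- n / 4, beating n^(1-γ).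
  filter_upwards [(tendsto_window v.length).eventually (h1.eventually_const_lt (half_lt_self hv)),
    h2.eventually_lt_const (show (0 : ℝ) < p / 4 by positivity),
    eventually_ge_atTop (2 * v.length + 1)] with n h3 h4 hn
  rw [isFrequent_concat_iff, start_eq (by lia), show ∀ a : ℤ, 0 - a + 1 = 1 - a by intro a; ring]
  have hn0 : (0 : ℝ) < n := by exact_mod_cast (show 0 < n by lia)
  have hm : (n : ℝ) ≤ 2 * ((n + 1 - v.length : ℕ) : ℝ) := by
    exact_mod_cast (show n ≤ 2 * (n + 1 - v.length) by lia)
  have hm0 : (0 : ℝ) < ((n + 1 - v.length : ℕ) : ℝ) := by linarith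
  rw [lt_div_iff₀ hm0] at h3
  rw [sub_eq_add_neg, Real.rpow_add hn0, Real.rpow_one]
  calc (n : ℝ) * (n : ℝ) ^ (-γ) ≤ n * (p / 4) := by gcongr
    _ ≤ (2 * ((n + 1 - v.length : ℕ) : ℝ)) * (p / 4) := by gcongr
    _ = p / 2 * ((n + 1 - v.length : ℕ) : ℝ) := by ring
    _ < _ := h3

/-- If some extension of `w` into the past changes the conditional probability of the next letter,
then `w` eventually fails the test. -/
lemma ae_eventually_not_nTest (hμ : Ergodic shift μ) {γ β : ℝ} (hγ : 0 < γ) (hβ : 0 < β)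
    {z w : List α} {y : α} (hz : 1 ≤ z.length) (hpos : 0 < μ.real (cyl 0 (z ++ w ++ [y])))
    (hne : μ.real (cyl 0 (w ++ [y])) / μ.real (cyl 0 w) ≠
      μ.real (cyl 0 (z ++ w ++ [y])) / μ.real (cyl 0 (z ++ w))) :
    ∀ᵐ x ∂μ, ∀ᶠ n : ℕ in atTop, ¬ NTest γ β n x w := by
  have hzw : 0 < μ.real (cyl 0 (z ++ w)) := by
    refine hpos.trans_le ?_
    rw [measureReal_def, ← measure_cyl_eq hμ.toMeasurePreserving (0 + 1), ← measureReal_def]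
    exact measureReal_mono fun x hx => (mem_cyl_concat_iff.1 hx).1
  have hw : 0 < μ.real (cyl 0 w) :=
    hzw.trans_le (measureReal_mono fun x hx => (mem_cyl_append_iff.1 hx).2)
  filter_upwards [ae_tendsto_empCond hμ w y hw.ne', ae_tendsto_empCond hμ (z ++ w) y hzw.ne',
    ae_eventually_isFrequent hμ hγ (z ++ w) y hpos] with x h1 h2 h3
  have h4 := (h1.sub h2).abs
  have h5 : Tendsto (fun n : ℕ => (n : ℝ) ^ (-β)) atTop (𝓝 0) :=
    (tendsto_rpow_neg_atTop hβ).comp tendsto_natCast_atTop_atTop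
  -- The empirical gap tends to a positive limit while the threshold tends to 0.
  filter_upwards [h5.eventually_lt h4 (abs_pos.2 (sub_ne_zero.2 hne)), h3,
    eventually_ge_atTop z.length] with n h6 h7 h8
  exact not_le.2 (h6.trans_le (le_csSup (bddAbove_empDeltaValues γ n x w) ⟨z, y, hz, h8, h7, rfl⟩))

end LawOfLargeNumbers

/-! ### From memory words to conditional laws given the past. -/

section MemoryLength

variable {Ω α : Type*} [MeasurableSpace Ω] [MeasurableSpace α]
  {P : Measure Ω} {X : ℤ → Ω → α}

lemma IsStationaryErgodic.measurable_path (hX : IsStationaryErgodic P X) : Measurable (path X) :=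
  measurable_pi_lambda _ hX.1

variable [MeasurableSingletonClass α]

lemma real_pastEvent_eq (hX : IsStationaryErgodic P X) (w : List α) :
    P.real (pastEvent X w) = (P.map (path X)).real (cyl 0 w) := by
  rw [map_measureReal_apply hX.measurable_path (measurableSet_cyl _ _)]
  rfl

lemma jointProb_eq (hX : IsStationaryErgodic P X) (w : List α) (y : α) :
    jointProb P X w y = (P.map (path X)).real (cyl 0 (w ++ [y])) := by
  rw [measureReal_def (P.map (path X)), ← measure_cyl_eq hX.2.toMeasurePreserving (0 + 1),
    ← measureReal_def, map_measureReal_apply hX.measurable_path (measurableSet_cyl _ _), jointProb]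
  congr 1
  ext ω
  simp only [Set.mem_preimage, mem_cyl_concat_iff]
  rfl

lemma condProb_eq (hX : IsStationaryErgodic P X) (w : List α) (y : α) :
    condProb P X y w = (P.map (path X)).real (cyl 0 (w ++ [y])) /
      (P.map (path X)).real (cyl 0 w) := by
  rw [condProb, jointProb_eq hX, real_pastEvent_eq hX]

variable [Countable α]

lemma tsum_measure_cyl_concat {μ : Measure (ℤ → α)} (hμ : MeasurePreserving shift μ μ)
    (w : List α) : ∑' y, μ (cyl 0 (w ++ [y])) = μ (cyl 0 w) := by
  have h : cyl 0 w = ⋃ y, cyl (0 + 1) (w ++ [y]) := by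
    ext x
    rw [Set.mem_iUnion]
    simp only [mem_cyl_concat_iff, exists_and_left, exists_eq', and_true]
  rw [h, measure_iUnion _ fun y => measurableSet_cyl _ _]
  · simp only [measure_cyl_eq hμ (0 + 1)]
  · intro y y' hy
    refine Set.disjoint_left.2 fun x hx hx' => hy ?_
    rw [← (mem_cyl_concat_iff.1 hx).2, (mem_cyl_concat_iff.1 hx').2]

lemma tsum_measure_cyl_concat_div_le_one {μ : Measure (ℤ → α)} (hμ : MeasurePreserving shift μ μ)
    (w : List α) : ∑' y, μ (cyl 0 (w ++ [y])) / μ (cyl 0 w) ≤ 1 := by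
  simp only [div_eq_mul_inv, ENNReal.tsum_mul_right]
  rw [tsum_measure_cyl_concat hμ, ← div_eq_mul_inv]
  exact ENNReal.div_self_le_one

/-- `PastIrrelevant` controls only letters with p(uw, y) > 0, so at first it yields only μ(uwy) ≤ Q
y · μ(uw) for all y. Summed over y the left side is μ(uw) and the right side at most μ(uw), so no
inequality can be strict. -/
lemma PastIrrelevant.hasNextProb [IsProbabilityMeasure P] (hX : IsStationaryErgodic P X)
    {w : List α} (hw : PastIrrelevant P X w) (y : α) :
    HasNextProb (P.map (path X)) w y
      (P.map (path X) (cyl 0 (w ++ [y])) / P.map (path X) (cyl 0 w)) := by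
  have : IsProbabilityMeasure (P.map (path X)) :=
    Measure.isProbabilityMeasure_map hX.measurable_path.aemeasurable
  have hμ := hX.2.toMeasurePreserving
  set μ := P.map (path X) with hμdef
  set Q : α → ℝ≥0∞ := fun y => μ (cyl 0 (w ++ [y])) / μ (cyl 0 w) with hQ
  have hconcat : ∀ (u : List α) (y : α), μ (cyl 0 (u ++ [y])) ≤ μ (cyl 0 u) := fun u y => by
    rw [← tsum_measure_cyl_concat hμ u]
    exact ENNReal.le_tsum y
  have hQ1 : ∑' y, Q y ≤ 1 := tsum_measure_cyl_concat_div_le_one hμ w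
  change HasNextProb μ w y (Q y)
  intro u
  -- The empty extension is not covered by `PastIrrelevant`; there the identity is the definition of
  -- Q, or 0 = 0 if w is null.
  rcases u.eq_nil_or_concat with rfl | ⟨u', c, hu⟩
  · rcases eq_or_ne (μ (cyl 0 w)) 0 with h0 | h0
    · have := hconcat w y
      rw [h0] at this
      simpa [h0] using this
    · simp only [hQ, List.nil_append]
      exact (ENNReal.div_mul_cancel h0 (measure_ne_top _ _)).symm
  have hle : ∀ y, μ (cyl 0 (u ++ w ++ [y])) ≤ Q y * μ (cyl 0 (u ++ w)) := fun y => by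
    rcases eq_or_ne (μ (cyl 0 (u ++ w ++ [y]))) 0 with h0 | h0
    · rw [h0]
      exact zero_le
    · have hpos : 0 < jointProb P X (u ++ w) y := by
        rw [jointProb_eq hX]
        exact ENNReal.toReal_pos h0 (measure_ne_top _ _)
      have h1 := hw u y (by simp [hu]) hpos
      rw [condProb_eq hX, condProb_eq hX, measureReal_def, measureReal_def, measureReal_def,
        measureReal_def, ← ENNReal.toReal_div, ← ENNReal.toReal_div, ← hμdef] at h1
      have h2 : μ (cyl 0 (u ++ w)) ≠ 0 := fun h => h0 (le_zero_iff.1 (h ▸ hconcat (u ++ w) y))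
      have h3 : μ (cyl 0 w) ≠ 0 := fun h => h2 <| measure_mono_null
        (fun x hx => (mem_cyl_append_iff.1 hx).2) h
      rw [ENNReal.toReal_eq_toReal_iff' (ENNReal.div_ne_top (measure_ne_top _ _) h3)
        (ENNReal.div_ne_top (measure_ne_top _ _) h2)] at h1
      simp only [hQ]
      rw [h1, ENNReal.div_mul_cancel h2 (measure_ne_top _ _)]
  refine (hle y).antisymm (not_lt.1 fun hlt => ?_)
  have h1 := ENNReal.tsum_lt_tsum
    (by rw [tsum_measure_cyl_concat hμ]; exact measure_ne_top _ _) hle hlt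
  rw [tsum_measure_cyl_concat hμ, ENNReal.tsum_mul_right] at h1
  exact absurd (mul_le_mul_left hQ1 (μ (cyl 0 (u ++ w)))) (by simpa using h1)

lemma ae_eventually_nTest_iff [IsProbabilityMeasure P] (hX : IsStationaryErgodic P X) {γ β : ℝ}
    (hγ : 0 < γ) (hβ0 : 0 < β) (hβ1 : β < (1 - γ) / 2) (w : List α) :
    ∀ᵐ ω ∂P, ∀ᶠ n : ℕ in atTop, NTest γ β n (path X ω) w ↔ PastIrrelevant P X w := by
  have hp : IsProbabilityMeasure (P.map (path X)) :=
    Measure.isProbabilityMeasure_map hX.measurable_path.aemeasurable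
  have hμ := hX.2.toMeasurePreserving
  refine ae_of_ae_map hX.measurable_path.aemeasurable
    (p := fun x => ∀ᶠ n : ℕ in atTop, NTest γ β n x w ↔ PastIrrelevant P X w) ?_
  by_cases hw : PastIrrelevant P X w
  · filter_upwards [ae_eventually_nTest hμ (hw.hasNextProb hX)
      (tsum_measure_cyl_concat_div_le_one hμ w) hβ0 hβ1] with x hx
    filter_upwards [hx] with n hn
    exact iff_of_true hn hw
  · have hw' := hw
    simp only [PastIrrelevant, not_forall] at hw'
    obtain ⟨z, y, hz, hpos, hne⟩ := hw'
    rw [jointProb_eq hX] at hpos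
    rw [condProb_eq hX, condProb_eq hX] at hne
    filter_upwards [ae_eventually_not_nTest hX.2 hγ hβ0 hz hpos hne] with x hx
    filter_upwards [hx] with n hn
    exact iff_of_false hn hw

end MemoryLength

/-! ### The estimator and the conclusion. -/

lemma chi_eq {α : Type*} {γ β : ℝ} {n K : ℕ} {x : ℤ → α} (hK : K < n)
    (hyes : NTest γ β n x (seg x 0 K)) (hno : ∀ k < K, ¬ NTest γ β n x (seg x 0 k)) :
    chi γ β n x = K := by
  refine IsLeast.csInf_eq ⟨Or.inl ⟨hK, hyes⟩, ?_⟩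
  rintro k (⟨-, hk⟩ | rfl)
  · exact not_lt.1 fun h => hno k h hk
  · exact hK.le

/-- A finite memory length is attained. -/
lemma exists_memoryLength_eq {Ω α : Type*} [MeasurableSpace Ω] {P : Measure Ω} {X : ℤ → Ω → α}
    {x : ℤ → α} (h : memoryLength P X x < ⊤) :
    ∃ K : ℕ, memoryLength P X x = K ∧ PastIrrelevant P X (seg x 0 K) ∧
      ∀ k < K, ¬ PastIrrelevant P X (seg x 0 k) := by
  classical
  have hex : ∃ k, PastIrrelevant P X (seg x 0 k) := by
    simp only [memoryLength, iInf_lt_iff] at h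
    obtain ⟨k, hk, -⟩ := h
    exact ⟨k, hk⟩
  refine ⟨Nat.find hex, le_antisymm (iInf₂_le (Nat.find hex) (Nat.find_spec hex)) ?_, Nat.find_spec hex,
    fun k hk => Nat.find_min hex hk⟩
  exact le_iInf₂ fun k hk => Nat.cast_le.2 (Nat.find_min' hex hk)

end
end FinitarilyMarkovian

theorem mainTheorem1 {Ω α : Type*} [MeasurableSpace Ω]
    [Countable α] [MeasurableSpace α] [MeasurableSingletonClass α]
    (P : Measure Ω) [IsProbabilityMeasure P] (X : ℤ → Ω → α)
    (hX : FinitarilyMarkovian.IsStationaryErgodic P X)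
    (hFM : FinitarilyMarkovian.IsFinitarilyMarkovian P X)
    (γ β : ℝ) (hγ0 : 0 < γ) (hγ1 : γ < 1) (hβ0 : 0 < β) (hβ1 : β < (1 - γ) / 2) :
    ∀ᵐ ω ∂P, ∀ᶠ n : ℕ in atTop,
      (FinitarilyMarkovian.chi γ β n (FinitarilyMarkovian.path X ω) : ℕ∞) =
        FinitarilyMarkovian.memoryLength P X (FinitarilyMarkovian.path X ω) := by
  -- One null set serves all words, so the path-dependent suffixes may be inserted afterwards.
  have htest := ae_all_iff.2 fun w : List α =>
    FinitarilyMarkovian.ae_eventually_nTest_iff hX hγ0 hβ0 hβ1 w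
  filter_upwards [hFM, htest] with ω hω htest
  obtain ⟨K, hK, hyes, hno⟩ := FinitarilyMarkovian.exists_memoryLength_eq hω
  set x := FinitarilyMarkovian.path X ω
  have hsmall : ∀ᶠ n : ℕ in atTop, ∀ k ∈ Finset.range K,
      ¬ FinitarilyMarkovian.NTest γ β n x (FinitarilyMarkovian.seg x 0 k) :=
    (Finset.eventually_all _).2 fun k hk =>
      (htest _).mono fun n hn h => hno k (Finset.mem_range.1 hk) (hn.1 h)
  filter_upwards [eventually_gt_atTop K, htest (FinitarilyMarkovian.seg x 0 K), hsmall]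
    with n hn h1 h2
  rw [hK, FinitarilyMarkovian.chi_eq hn (h1.2 hyes) fun k hk => h2 k (Finset.mem_range.2 hk)]
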